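/- Let $X_1,X_2$ be independent real random variables with probability density functions $f_1,f_2$. All logarithms are natural. A weight function is a measurable function $\phi:\mathbb R\to[0,\infty)$. For a random variable $Z$ with density $f_Z$ put $h^{\rm w}_\phi(Z)=-\mathbb E[\phi(Z)\log f_Z(Z)]$, and let $$\alpha(\phi)=\tan^{-1}\Big[\exp\Big(\frac{h^{\rm w}_\phi(X_2)}{\mathbb E\phi(X_2)}-\frac{h^{\rm w}_\phi(X_1)}{\mathbb E\phi(X_1)}\Big)\Big].$$ For $\gamma>0$ let $M(Z;\gamma)=\mathbb E\big[(Z-\mathbb E[Z\mid Z\sqrt\gamma+N])^2\big]$, where $N\sim N(0,1)$ is independent of $Z$. For $\gamma_0>0$, $\delta>0$ and an angle $\alpha\in(0,\pi/2)$, put $Y_1=X_1/\cos\alpha$, $Y_2=X_2/\sin\alpha$, and say that condition $H(\alpha)$ holds if, for each of $Z=Y_1,\,Y_2,\,X_1+X_2$, (a) $\mathbb E|\log f_Z(Z)|<\infty$ and $\mathbb E[Z^2]<\infty$; (b) for every $\gamma>0$ there is an integrable function $\xi(Z,N)$ such that, almost surely, $\big|\log\mathbb E\big[f_Z\big(Z+\tfrac{N-N'}{\sqrt\gamma}\big)\,\big|\,Z,N\big]\big|\le\xi(Z,N)$,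 where $N,N'\sim N(0,1)$ and $Z,N,N'$ are independent; (c) $\gamma\mapsto M(Z;\gamma)$ is continuous at $\gamma_0$; and moreover $$M(X_1+X_2;\gamma_0)\ \ge\ M(Y_1;\gamma_0)\cos^2\alpha+M(Y_2;\gamma_0)\sin^2\alpha+\delta .$$ Then there is a constant $c>0$, depending only on $\gamma_0,\delta,f_1,f_2$, such that the following holds for every $\bar\phi>0$, with $\epsilon_0=c\,\bar\phi$. Let $\phi$ be a weight function with $|\phi(x)-\bar\phi|<\epsilon$ for all $x$, where $\epsilon<\epsilon_0$. If condition $H(\alpha)$ holds for $\alpha=\alpha(\phi)$, or for the angle $\alpha=\alpha(\bar\phi)=\tan^{-1}[\exp(h(X_2)-h(X_1))]$ of the constant weight function $\bar\phi$ (here $h=h^{\rm w}_1$ is the ordinary differential entropy), then the weighted Lieb splitting inequality holds for $\phi$: with $\alpha=\alpha(\phi)$, $Y_1=X_1/\cos\alpha$, $Y_2=X_2/\sin\alpha$, $\phi_c(x)=\phi(x\cos\alpha)$ and $\phi_s(x)=\phi(x\sin\alpha)$, $$(\cos\alpha)^2h^{\rm w}_{\phi_c}(Y_1)+(\sin\alpha)^2h^{\rm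 w}_{\phi_s}(Y_2)\le h^{\rm w}_\phi(X_1+X_2).$$ -/

import Mathlib

open MeasureTheory ProbabilityTheory

namespace WeightedEntropy

noncomputable section

universe u

/-- The probability density function of a law `μ` on `ℝ` with respect to Lebesgue measure. -/
def density (μ : Measure ℝ) (x : ℝ) : ℝ := (μ.rnDeriv volume x).toReal

/-- The random variable `X` has the probability density function `f`. -/
structure HasDensity {Ω : Type u} [MeasurableSpace Ω] (P : Measure Ω) (X : Ω → ℝ) (f : ℝ → ℝ) :
    Prop where
  measurable : Measurable X
  measurable_density : Measurable f
  nonneg : ∀ x, 0 ≤ f x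
  map_eq : P.map X = volume.withDensity (fun x => ENNReal.ofReal (f x))

/-- Weight functions: measurable and non-negative. -/
structure IsWeight (φ : ℝ → ℝ) : Prop where
  measurable : Measurable φ
  nonneg : ∀ x, 0 ≤ φ x

/-- The weighted differential entropy `- E [φ(Z) log f_Z(Z)]`. -/
def weightedEntropy {Ω : Type u} [MeasurableSpace Ω] (φ : ℝ → ℝ) (P : Measure Ω) (Z : Ω → ℝ) : ℝ :=
  -∫ ω, φ (Z ω) * Real.log (density (P.map Z) (Z ω)) ∂P

/-- The angle
`α = arctan (exp (h_φ(X₂) / E φ(X₂) - h_φ(X₁) / E φ(X₁)))` attached to a weight function `φ`. -/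
def angle {Ω : Type u} [MeasurableSpace Ω] (φ : ℝ → ℝ) (P : Measure Ω) (X₁ X₂ : Ω → ℝ) : ℝ :=
  Real.arctan (Real.exp
    (weightedEntropy φ P X₂ / (∫ ω, φ (X₂ ω) ∂P) - weightedEntropy φ P X₁ / (∫ ω, φ (X₁ ω) ∂P)))

/-- The weighted Lieb splitting inequality for the weight function `φ`: with `α` the angle
of `φ`, `Y₁ = X₁ / cos α`, `Y₂ = X₂ / sin α`, `φ_c(x) = φ(x cos α)`, `φ_s(x) = φ(x sin α)`,
`cos² α h_{φ_c}(Y₁) + sin² α h_{φ_s}(Y₂) ≤ h_φ(X₁ + X₂)`. -/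
def WLSI {Ω : Type u} [MeasurableSpace Ω] (φ : ℝ → ℝ) (P : Measure Ω) (X₁ X₂ : Ω → ℝ) : Prop :=
  let α := angle φ P X₁ X₂
  (Real.cos α) ^ 2 *
      weightedEntropy (fun x => φ (x * Real.cos α)) P (fun ω => X₁ ω / Real.cos α) +
    (Real.sin α) ^ 2 *
      weightedEntropy (fun x => φ (x * Real.sin α)) P (fun ω => X₂ ω / Real.sin α) ≤
  weightedEntropy φ P (fun ω => X₁ ω + X₂ ω)

/-- The minimum mean square error `E [(Z - E[Z | Z √γ + N])²]`, where `Z` has law `μ` and `N` is a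
standard normal variable independent of `Z`; the pair `(Z, N)` is realized on `ℝ × ℝ`. -/
def mmse (μ : Measure ℝ) (γ : ℝ) : ℝ :=
  let ν : Measure (ℝ × ℝ) := μ.prod (gaussianReal 0 1)
  let 𝒢 : MeasurableSpace (ℝ × ℝ) :=
    MeasurableSpace.comap (fun p : ℝ × ℝ => p.1 * Real.sqrt γ + p.2) inferInstance
  ∫ p, (p.1 - (ν[(fun q : ℝ × ℝ => q.1) | 𝒢]) p) ^ 2 ∂ν

/-- `E |log f_Z(Z)| < ∞` and `E Z² < ∞`. -/
def FiniteEntropyAndVariance {Ω : Type u} [MeasurableSpace Ω] (P : Measure Ω) (Z : Ω → ℝ) : Prop :=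
  Integrable (fun ω => Real.log (density (P.map Z) (Z ω))) P ∧ Integrable (fun ω => Z ω ^ 2) P

/-- For a variable `Z` with law `μ` and standard normal `N`, `N'`, with `Z`, `N`, `N'` independent
(the triple is realized on `ℝ × (ℝ × ℝ)`): for every `γ > 0` there is an integrable `ξ(Z, N)` with
`|log E [f_Z(Z + (N - N') / √γ) | Z, N]| ≤ ξ(Z, N)` almost surely. -/
def LogSmoothedDominated (μ : Measure ℝ) : Prop :=
  let g : Measure ℝ := gaussianReal 0 1
  let ν : Measure (ℝ × (ℝ × ℝ)) := μ.prod (g.prod g)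
  let 𝒢 : MeasurableSpace (ℝ × (ℝ × ℝ)) :=
    MeasurableSpace.comap (fun p : ℝ × (ℝ × ℝ) => (p.1, p.2.1)) inferInstance
  ∀ γ : ℝ, 0 < γ → ∃ ξ : ℝ × ℝ → ℝ, Integrable ξ (μ.prod g) ∧
    ∀ᵐ p ∂ν,
      |Real.log ((ν[(fun q : ℝ × (ℝ × ℝ) =>
        density μ (q.1 + (q.2.1 - q.2.2) / Real.sqrt γ)) | 𝒢]) p)| ≤ ξ (p.1, p.2.1)

/-- What is required of each of `Z = Y₁, Y₂, X₁ + X₂`: the integrability conditions, and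
continuity of `γ ↦ M(Z; γ)` at `γ₀`. -/
def Regular {Ω : Type u} [MeasurableSpace Ω] (P : Measure Ω) (Z : Ω → ℝ) (γ₀ : ℝ) : Prop :=
  FiniteEntropyAndVariance P Z ∧ LogSmoothedDominated (P.map Z) ∧
    ContinuousAt (mmse (P.map Z)) γ₀

/-- The hypotheses on `Y₁ = X₁ / cos α`, `Y₂ = X₂ / sin α` and `X₁ + X₂` for the angle `α`:
all three are regular at `γ₀`, and
`M(X₁ + X₂; γ₀) ≥ cos² α M(Y₁; γ₀) + sin² α M(Y₂; γ₀) + δ`. -/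
def MMSEGap {Ω : Type u} [MeasurableSpace Ω] (P : Measure Ω) (X₁ X₂ : Ω → ℝ) (γ₀ δ α : ℝ) :
    Prop :=
  let Y₁ : Ω → ℝ := fun ω => X₁ ω / Real.cos α
  let Y₂ : Ω → ℝ := fun ω => X₂ ω / Real.sin α
  let X : Ω → ℝ := fun ω => X₁ ω + X₂ ω
  Regular P Y₁ γ₀ ∧ Regular P Y₂ γ₀ ∧ Regular P X γ₀ ∧
    mmse (P.map Y₁) γ₀ * (Real.cos α) ^ 2 + mmse (P.map Y₂) γ₀ * (Real.sin α) ^ 2 + δ ≤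
      mmse (P.map X) γ₀

end

end WeightedEntropy

/-!
The weighted inequality is a perturbation of the unweighted Lieb splitting inequality
`c² (h(X₁) - log c) + s² (h(X₂) - log s) ≤ h(X₁ + X₂)`, `c² + s² = 1`, which is the entropy power
inequality in another form. Over all `(c, s)` the left side is largest at the angle of a constant
weight (`splitting_le_of_balanced`). There are two cases.

If the inequality is strict at that angle, then the deficit, which depends on the densities only,
dominates all the errors caused by replacing a constant weight by a nearby one
(`weighted_splitting_of_gap`), whatever the angle is.

If it is not strict, then it is an equality, and `X₁` and `X₂` are normal with variances in the
ratio `c² : s²` (`gaussian_of_lieb_splitting_eq`). For normal laws the mean square error is explicit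
(`mmse_gaussianReal`); the gap of mean square errors is a continuous function of the angle and
vanishes at the angle of a constant weight. The angle of a nearly constant weight is close to that
one, so the gap cannot reach `δ` and the hypotheses cannot hold.

The splitting inequality and its equality case are proved by transport to the normal law. Let
`Sᵢ = Φ⁻¹ ∘ Fᵢ` be the normal score of `Xᵢ`, and rotate the scores: `z = c S₁ + s S₂`,
`w = c S₂ - s S₁`. For a fixed value of `x = x₁ + x₂` the score `w` is a monotone function of `x₂`
with derivative `s S₁' + c S₂'`, so that the integral of `φ(w) (s S₁' + c S₂')` over `x₂` is at
most one (`lintegral_gaussian_rotatedScore_le_one`). Integrating against the density `f` of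
`X₁ + X₂`, and using `fᵢ = φ(Sᵢ) Sᵢ'` and `φ(S₁) φ(S₂) = φ(z) φ(w)`, one finds that
`u = f(x₁ + x₂) (c / S₁' + s / S₂') / φ(z)` has expectation at most one
(`lintegral_transportRatio_le_one`). By the arithmetic-geometric mean inequality, `log u` is at
least `log f - c² log (c S₁') - s² log (s S₂') - log φ(z)`, and the expectation of this is minus
the deficit; now `log u ≤ u - 1` gives the inequality.

In the equality case, `c S₁' = s S₂'` is constant where the densities are positive. That the
densities have no gaps inside their intervals comes from the substitution, which must lose no mass:
`f(x₁ + x₂)` is positive when both densities are, and vanishes when exactly one of them does.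
Two nearby translates of a set of positive measure overlap in positive measure, so the positivity
set and the gap of a density would lie at a positive distance from each other, which is impossible
in an interval (`density_pos_ae_cdfInterval`). Hence the scores are affine.
-/

namespace WeightedEntropy

open Set Filter Topology
open scoped Pointwise

/-! ### Distribution functions and densities -/

theorem density_nonneg (μ : Measure ℝ) (x : ℝ) : 0 ≤ density μ x := ENNReal.toReal_nonneg

theorem measurable_density (μ : Measure ℝ) : Measurable (density μ) :=
  (Measure.measurable_rnDeriv _ _).ennreal_toReal

theorem ofReal_density_ae (μ : Measure ℝ) [IsProbabilityMeasure μ] :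
    (fun x => ENNReal.ofReal (density μ x)) =ᵐ[volume] μ.rnDeriv volume := by
  filter_upwards [Measure.rnDeriv_lt_top μ volume] with x hx
  exact ENNReal.ofReal_toReal hx.ne

theorem withDensity_density {μ : Measure ℝ} [IsProbabilityMeasure μ] (hμ : μ ≪ volume) :
    volume.withDensity (fun x => ENNReal.ofReal (density μ x)) = μ := by
  rw [withDensity_congr_ae (ofReal_density_ae μ), Measure.withDensity_rnDeriv_eq _ _ hμ]

theorem density_pos_ae {μ : Measure ℝ} [IsProbabilityMeasure μ] (hμ : μ ≪ volume) :
    ∀ᵐ x ∂μ, 0 < density μ x := by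
  filter_upwards [Measure.rnDeriv_pos hμ, hμ.ae_le (Measure.rnDeriv_lt_top μ volume)] with x h1 h2
  exact ENNReal.toReal_pos h1.ne' h2.ne

theorem integrable_density (μ : Measure ℝ) [IsProbabilityMeasure μ] :
    Integrable (density μ) volume := Measure.integrable_toReal_rnDeriv

theorem cdf_ae_hasDerivAt (μ : Measure ℝ) [IsProbabilityMeasure μ] :
    ∀ᵐ x, HasDerivAt (cdf μ) (density μ x) x := by
  have h := (cdf μ).ae_hasDerivAt
  rwa [measure_cdf] at h

theorem cdf_eq_setIntegral_density {μ : Measure ℝ} [IsProbabilityMeasure μ] (hμ : μ ≪ volume)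
    (x : ℝ) : cdf μ x = ∫ y in Iic x, density μ y := by
  rw [cdf_eq_real]
  exact (Measure.setIntegral_toReal_rnDeriv hμ _).symm

theorem cdf_eq_add_integral_density {μ : Measure ℝ} [IsProbabilityMeasure μ] (hμ : μ ≪ volume)
    (a x : ℝ) : cdf μ x = cdf μ a + ∫ y in a..x, density μ y := by
  rw [cdf_eq_setIntegral_density hμ, cdf_eq_setIntegral_density hμ,
    ← intervalIntegral.integral_Iic_sub_Iic (integrable_density μ).integrableOn
      (integrable_density μ).integrableOn]
  ring

theorem continuous_cdf {μ : Measure ℝ} [IsProbabilityMeasure μ] (hμ : μ ≪ volume) :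
    Continuous (cdf μ) := by
  have : (cdf μ : ℝ → ℝ) = fun x => cdf μ 0 + ∫ y in (0:ℝ)..x, density μ y :=
    funext fun x => cdf_eq_add_integral_density hμ 0 x
  rw [this]
  exact continuous_const.add (intervalIntegral.continuous_primitive
    (fun _ _ => (integrable_density μ).intervalIntegrable) 0)

/-- A distribution function is differentiable at each point near which the density agrees almost
everywhere with a function continuous at that point. -/
theorem hasDerivAt_cdf_of_density_eq {μ : Measure ℝ} [IsProbabilityMeasure μ] (hμ : μ ≪ volume)
    {s : Set ℝ} {g : ℝ → ℝ} {x : ℝ} (hs : s ∈ 𝓝 x) (hg : ContinuousAt g x)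
    (h : ∀ᵐ y, y ∈ s → density μ y = g y) : HasDerivAt (cdf μ) (g x) x := by
  have h1 : HasDerivAt (fun u => ∫ y in (0:ℝ)..u, density μ y) (g x) x := by
    apply intervalIntegral.integral_hasDerivAt_of_tendsto_ae_right
      (integrable_density μ).intervalIntegrable
      (measurable_density μ).stronglyMeasurable.stronglyMeasurableAtFilter
    refine (hg.tendsto.mono_left inf_le_left).congr' ?_
    filter_upwards [mem_inf_of_left hs, mem_inf_of_right h] with y hy hy'
    exact (hy' hy).symm
  have : (cdf μ : ℝ → ℝ) = fun x => cdf μ 0 + ∫ y in (0:ℝ)..x, density μ y :=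
    funext fun x => cdf_eq_add_integral_density hμ 0 x
  rw [this]
  exact h1.const_add _

/-- The open interval on which the distribution function of `μ` lies strictly between `0` and `1`,
that is, the interior of the convex hull of the support when `μ` has a density. -/
def cdfInterval (μ : Measure ℝ) : Set ℝ := {x | cdf μ x ∈ Ioo (0:ℝ) 1}

theorem isOpen_cdfInterval {μ : Measure ℝ} [IsProbabilityMeasure μ] (hμ : μ ≪ volume) :
    IsOpen (cdfInterval μ) := isOpen_Ioo.preimage (continuous_cdf hμ)

theorem ordConnected_cdfInterval (μ : Measure ℝ) : (cdfInterval μ).OrdConnected :=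
  ordConnected_Ioo.preimage_mono (monotone_cdf μ)

theorem exists_cdf_eq {μ : Measure ℝ} [IsProbabilityMeasure μ] (hμ : μ ≪ volume) {p : ℝ}
    (hp : p ∈ Ioo (0:ℝ) 1) : ∃ x, cdf μ x = p :=
  mem_range_of_exists_le_of_exists_ge (continuous_cdf hμ)
    ((tendsto_cdf_atBot μ).eventually (ge_mem_nhds hp.1)).exists
    ((tendsto_cdf_atTop μ).eventually (le_mem_nhds hp.2)).exists

theorem measureReal_cdf_lt_le {μ : Measure ℝ} [IsProbabilityMeasure μ] (hμ : μ ≪ volume) {p : ℝ}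
    (hp : p ∈ Ioo (0:ℝ) 1) : μ.real {x | cdf μ x < p} ≤ p := by
  obtain ⟨x, rfl⟩ := exists_cdf_eq hμ hp
  nth_rw 2 [cdf_eq_real]
  exact measureReal_mono fun y hy => le_of_lt ((monotone_cdf μ).reflect_lt hy)

theorem measureReal_cdf_le_le {μ : Measure ℝ} [IsProbabilityMeasure μ] (hμ : μ ≪ volume) {p : ℝ}
    (hp : p ∈ Ico (0:ℝ) 1) : μ.real {x | cdf μ x ≤ p} ≤ p := by
  refine le_of_forall_gt_imp_ge_of_dense fun q hq => ?_
  rcases lt_or_ge q 1 with h | h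
  · exact (measureReal_mono fun y (hy : _ ≤ _) => lt_of_le_of_lt hy hq).trans
      (measureReal_cdf_lt_le hμ ⟨hp.1.trans_lt hq, h⟩)
  · exact measureReal_le_one.trans h

/-- The probability integral transform: `F(X)` is uniform on `(0, 1)` when the distribution
function `F` of `X` is continuous. -/
theorem measureReal_cdf_le {μ : Measure ℝ} [IsProbabilityMeasure μ] (hμ : μ ≪ volume) {p : ℝ}
    (hp : p ∈ Ioo (0:ℝ) 1) : μ.real {x | cdf μ x ≤ p} = p := by
  refine le_antisymm (measureReal_cdf_le_le hμ ⟨hp.1.le, hp.2⟩) ?_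
  obtain ⟨x, rfl⟩ := exists_cdf_eq hμ hp
  nth_rw 1 [cdf_eq_real]
  exact measureReal_mono fun y hy => monotone_cdf μ hy

theorem mem_cdfInterval_ae {μ : Measure ℝ} [IsProbabilityMeasure μ] (hμ : μ ≪ volume) :
    ∀ᵐ x ∂μ, x ∈ cdfInterval μ := by
  have h0 : ∀ᵐ x ∂μ, 0 < cdf μ x := by
    have := le_antisymm (measureReal_cdf_le_le hμ (p := 0) ⟨le_rfl, one_pos⟩) measureReal_nonneg
    rw [measureReal_eq_zero_iff] at this
    simpa [ae_iff] using this
  have h1 : ∀ᵐ x ∂μ, cdf μ x < 1 := by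
    have hle : μ.real {x | 1 ≤ cdf μ x} ≤ 0 := by
      refine le_of_forall_gt_imp_ge_of_dense fun q hq => ?_
      rcases lt_or_ge q 1 with h | h
      · have hm : MeasurableSet {x | cdf μ x ≤ 1 - q} :=
          (continuous_cdf hμ).measurable measurableSet_Iic
        have h2 := measureReal_cdf_le hμ (p := 1 - q) ⟨by linarith, by linarith⟩
        have h3 : μ.real {x | cdf μ x ≤ 1 - q}ᶜ = q := by
          rw [probReal_compl_eq_one_sub hm, h2]; ring
        rw [← h3]
        refine measureReal_mono fun y (hy : 1 ≤ cdf μ y) => ?_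
        simp only [mem_compl_iff, mem_ofPred_eq, not_le]
        linarith
      · exact measureReal_le_one.trans h
    have := le_antisymm hle measureReal_nonneg
    rw [measureReal_eq_zero_iff] at this
    simpa [ae_iff] using this
  filter_upwards [h0, h1] with x hx hx' using ⟨hx, hx'⟩

/-! ### The normal score -/

theorem gaussian_absolutelyContinuous : gaussianReal 0 1 ≪ volume :=
  gaussianReal_absolutelyContinuous 0 one_ne_zero

theorem continuous_gaussianPDFReal (m : ℝ) (v : NNReal) : Continuous (gaussianPDFReal m v) := by
  rw [gaussianPDFReal_def]; fun_prop

theorem hasDerivAt_cdf_gaussian (x : ℝ) :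
    HasDerivAt (cdf (gaussianReal 0 1)) (gaussianPDFReal 0 1 x) x := by
  refine hasDerivAt_cdf_of_density_eq gaussian_absolutelyContinuous univ_mem
    (continuous_gaussianPDFReal 0 1).continuousAt ?_
  filter_upwards [rnDeriv_gaussianReal 0 1] with y hy _
  rw [density, hy, toReal_gaussianPDF]

theorem strictMono_cdf_gaussian : StrictMono (cdf (gaussianReal 0 1)) :=
  strictMono_of_hasDerivAt_pos hasDerivAt_cdf_gaussian
    fun x => gaussianPDFReal_pos 0 1 x one_ne_zero

theorem cdf_gaussian_mem (x : ℝ) : cdf (gaussianReal 0 1) x ∈ Ioo (0:ℝ) 1 :=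
  ⟨(cdf_nonneg _ (x - 1)).trans_lt (strictMono_cdf_gaussian (by linarith)),
    (strictMono_cdf_gaussian (by linarith : x < x + 1)).trans_le (cdf_le_one _ _)⟩

open Classical in
/-- The quantile function of the standard normal law on `(0, 1)`, extended by `0`. -/
noncomputable def gaussianQuantile : ℝ → ℝ :=
  (Ioo (0:ℝ) 1).piecewise (Function.invFun (cdf (gaussianReal 0 1))) 0

theorem cdf_gaussianQuantile {p : ℝ} (hp : p ∈ Ioo (0:ℝ) 1) :
    cdf (gaussianReal 0 1) (gaussianQuantile p) = p := by
  rw [gaussianQuantile, piecewise_eq_of_mem _ _ _ hp]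
  exact Function.invFun_eq (exists_cdf_eq gaussian_absolutelyContinuous hp)

theorem gaussianQuantile_cdf (x : ℝ) : gaussianQuantile (cdf (gaussianReal 0 1) x) = x :=
  strictMono_cdf_gaussian.injective (cdf_gaussianQuantile (cdf_gaussian_mem x))

theorem strictMonoOn_gaussianQuantile : StrictMonoOn gaussianQuantile (Ioo 0 1) := by
  intro p hp q hq hpq
  apply strictMono_cdf_gaussian.lt_iff_lt.1
  rwa [cdf_gaussianQuantile hp, cdf_gaussianQuantile hq]

theorem continuousAt_gaussianQuantile {p : ℝ} (hp : p ∈ Ioo (0:ℝ) 1) :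
    ContinuousAt gaussianQuantile p := by
  refine strictMonoOn_gaussianQuantile.continuousAt_of_image_mem_nhds (isOpen_Ioo.mem_nhds hp) ?_
  convert univ_mem
  refine eq_univ_of_forall fun x => ⟨_, cdf_gaussian_mem x, gaussianQuantile_cdf x⟩

theorem measurable_gaussianQuantile : Measurable gaussianQuantile := by
  classical
  have hc : ContinuousOn gaussianQuantile (Ioo 0 1) :=
    fun p hp => (continuousAt_gaussianQuantile hp).continuousWithinAt
  have : gaussianQuantile = (Ioo (0:ℝ) 1).piecewise gaussianQuantile 0 := by
    ext p
    by_cases hp : p ∈ Ioo (0:ℝ) 1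
    · simp [hp]
    · rw [piecewise_eq_of_notMem _ _ _ hp, gaussianQuantile, piecewise_eq_of_notMem _ _ _ hp]
  rw [this]
  exact hc.measurable_piecewise continuousOn_const measurableSet_Ioo

theorem hasDerivAt_gaussianQuantile {p : ℝ} (hp : p ∈ Ioo (0:ℝ) 1) :
    HasDerivAt gaussianQuantile (gaussianPDFReal 0 1 (gaussianQuantile p))⁻¹ p := by
  refine HasDerivAt.of_local_left_inverse (continuousAt_gaussianQuantile hp)
    (hasDerivAt_cdf_gaussian _) (gaussianPDFReal_pos 0 1 _ one_ne_zero).ne' ?_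
  filter_upwards [isOpen_Ioo.mem_nhds hp] with q hq using cdf_gaussianQuantile hq

/-- The normal score `Φ⁻¹ ∘ F` of a law with distribution function `F`: the monotone map carrying
the law to the standard normal law. -/
noncomputable def normalScore (μ : Measure ℝ) (x : ℝ) : ℝ := gaussianQuantile (cdf μ x)

/-- The almost everywhere derivative of the normal score on the interval where it is defined. -/
noncomputable def scoreDeriv (μ : Measure ℝ) (x : ℝ) : ℝ :=
  density μ x / gaussianPDFReal 0 1 (normalScore μ x)

theorem scoreDeriv_nonneg (μ : Measure ℝ) (x : ℝ) : 0 ≤ scoreDeriv μ x :=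
  div_nonneg (density_nonneg _ _) (gaussianPDFReal_nonneg _ _ _)

theorem density_eq_scoreDeriv (μ : Measure ℝ) (x : ℝ) :
    density μ x = gaussianPDFReal 0 1 (normalScore μ x) * scoreDeriv μ x := by
  rw [scoreDeriv, mul_div_cancel₀ _ (gaussianPDFReal_pos 0 1 _ one_ne_zero).ne']

theorem measurable_normalScore (μ : Measure ℝ) : Measurable (normalScore μ) :=
  measurable_gaussianQuantile.comp (monotone_cdf μ).measurable

theorem measurable_scoreDeriv (μ : Measure ℝ) : Measurable (scoreDeriv μ) :=
  (measurable_density μ).div ((measurable_gaussianPDFReal 0 1).comp (measurable_normalScore μ))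

theorem monotoneOn_normalScore (μ : Measure ℝ) : MonotoneOn (normalScore μ) (cdfInterval μ) :=
  fun _ hx _ hy hxy => strictMonoOn_gaussianQuantile.monotoneOn hx hy (monotone_cdf μ hxy)

theorem hasDerivAt_normalScore_of_cdf {μ : Measure ℝ} {x F' : ℝ} (hx : x ∈ cdfInterval μ)
    (h : HasDerivAt (cdf μ) F' x) :
    HasDerivAt (normalScore μ) (F' / gaussianPDFReal 0 1 (normalScore μ x)) x := by
  have := (hasDerivAt_gaussianQuantile hx).comp x h
  rwa [inv_mul_eq_div] at this

theorem normalScore_ae_hasDerivAt (μ : Measure ℝ) [IsProbabilityMeasure μ] :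
    ∀ᵐ x, x ∈ cdfInterval μ → HasDerivAt (normalScore μ) (scoreDeriv μ x) x := by
  filter_upwards [cdf_ae_hasDerivAt μ] with x hx hI using hasDerivAt_normalScore_of_cdf hI hx

/-- The normal score carries a law with a density to the standard normal law. -/
theorem map_normalScore {μ : Measure ℝ} [IsProbabilityMeasure μ] (hμ : μ ≪ volume) :
    μ.map (normalScore μ) = gaussianReal 0 1 := by
  have := Measure.isProbabilityMeasure_map (μ := μ) (measurable_normalScore μ).aemeasurable
  refine Measure.eq_of_cdf _ _ ?_
  ext t
  rw [cdf_eq_real, map_measureReal_apply (measurable_normalScore μ) measurableSet_Iic,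
    ← measureReal_cdf_le hμ (cdf_gaussian_mem t)]
  refine measureReal_congr ?_
  filter_upwards [mem_cdfInterval_ae hμ] with x hx
  refine propext ?_
  change normalScore μ x ≤ t ↔ cdf μ x ≤ cdf (gaussianReal 0 1) t
  rw [← strictMono_cdf_gaussian.le_iff_le, normalScore, cdf_gaussianQuantile hx]

/-! ### The transport inequality -/

/-- A monotone substitution does not increase the mass of the normal density: for the monotone
function `t ↦ c S₂(t) - s S₁(x - t)`, the integral of `φ(w(t)) w'(t)` is at most one. -/
theorem lintegral_gaussian_rotatedScore_le_one (μ₁ μ₂ : Measure ℝ) [IsProbabilityMeasure μ₁]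
    [IsProbabilityMeasure μ₂] (h₁ : μ₁ ≪ volume) (h₂ : μ₂ ≪ volume) {c s : ℝ} (hc : 0 ≤ c)
    (hs : 0 ≤ s) (x : ℝ) :
    ∫⁻ t in {t | x - t ∈ cdfInterval μ₁ ∧ t ∈ cdfInterval μ₂},
      ENNReal.ofReal (gaussianPDFReal 0 1 (c * normalScore μ₂ t - s * normalScore μ₁ (x - t)) *
        (s * scoreDeriv μ₁ (x - t) + c * scoreDeriv μ₂ t)) ≤ 1 := by
  set w : ℝ → ℝ := fun t => c * normalScore μ₂ t - s * normalScore μ₁ (x - t) with hw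
  set w' : ℝ → ℝ := fun t => s * scoreDeriv μ₁ (x - t) + c * scoreDeriv μ₂ t with hw'
  set J : Set ℝ := {t | x - t ∈ cdfInterval μ₁ ∧ t ∈ cdfInterval μ₂} with hJ
  have hJm : MeasurableSet J :=
    ((isOpen_cdfInterval h₁).measurableSet.preimage (by fun_prop)).inter
      (isOpen_cdfInterval h₂).measurableSet
  have hd : ∀ᵐ t, t ∈ J → HasDerivAt w (w' t) t := by
    have e1 := (Measure.measurePreserving_sub_left volume x).quasiMeasurePreserving.ae
      (normalScore_ae_hasDerivAt μ₁)
    filter_upwards [e1, normalScore_ae_hasDerivAt μ₂] with t ht1 ht2 ht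
    have a := (ht1 ht.1).comp t ((hasDerivAt_id t).const_sub x)
    have b : HasDerivAt w
        (c * scoreDeriv μ₂ t - s * (scoreDeriv μ₁ (x - t) * -1)) t :=
      ((ht2 ht.2).const_mul c).sub (a.const_mul s)
    exact b.congr_deriv (by simp only [hw']; ring)
  have hmono : MonotoneOn w J := by
    intro a ha b hb hab
    have i1 := monotoneOn_normalScore μ₁ hb.1 ha.1 (by linarith)
    have i2 := monotoneOn_normalScore μ₂ ha.2 hb.2 hab
    simp only [hw]
    gcongr
  -- a measurable subset of `J` of full measure on which `w` is differentiable
  obtain ⟨T, hTsub, hTm, hTae⟩ : ∃ T : Set ℝ, (∀ t ∈ T, t ∈ J → HasDerivAt w (w' t) t) ∧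
      MeasurableSet T ∧ ∀ᵐ t, t ∈ T := by
    refine ⟨(toMeasurable volume {t | ¬(t ∈ J → HasDerivAt w (w' t) t)})ᶜ, fun t ht => ?_,
      (measurableSet_toMeasurable _ _).compl, ?_⟩
    · by_contra hcon
      exact ht (subset_toMeasurable _ _ hcon)
    · refine compl_mem_ae_iff.2 ?_
      rw [measure_toMeasurable]
      exact hd
  have hJT : (J ∩ T : Set ℝ) =ᵐ[volume] J := by
    filter_upwards [hTae] with t ht
    exact propext ⟨fun h => h.1, fun h => ⟨h, ht⟩⟩
  rw [← setLIntegral_congr hJT]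
  calc ∫⁻ t in J ∩ T, ENNReal.ofReal (gaussianPDFReal 0 1 (w t) * w' t)
      = ∫⁻ t in J ∩ T, ENNReal.ofReal (w' t) * gaussianPDF 0 1 (w t) := by
        congr 1 with t
        rw [mul_comm, ENNReal.ofReal_mul', gaussianPDF]
        exact gaussianPDFReal_nonneg _ _ _
    _ = ∫⁻ y in w '' (J ∩ T), gaussianPDF 0 1 y :=
        (lintegral_image_eq_lintegral_deriv_mul_of_monotoneOn (hJm.inter hTm)
          (fun t ht => (hTsub t ht.2 ht.1).hasDerivWithinAt)
          (hmono.mono inter_subset_left) _).symm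
    _ ≤ ∫⁻ y, gaussianPDF 0 1 y := setLIntegral_le_lintegral _ _
    _ = 1 := lintegral_gaussianPDF_eq_one 0 one_ne_zero

theorem conv_absolutelyContinuous_volume {μ₁ μ₂ : Measure ℝ} [IsProbabilityMeasure μ₂]
    (h₂ : μ₂ ≪ volume) : (μ₁ ∗ μ₂) ≪ volume := Measure.conv_absolutelyContinuous h₂

/-- The integrand of the transport inequality on the plane: `f_X(x₁ + x₂) φ(w) (s S₁' + c S₂')`,
where `w = c S₂ - s S₁`. -/
noncomputable def transportKernel (μ₁ μ₂ : Measure ℝ) (c s : ℝ) (p : ℝ × ℝ) : ℝ :=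
  density (μ₁ ∗ μ₂) (p.1 + p.2) *
    (gaussianPDFReal 0 1 (c * normalScore μ₂ p.2 - s * normalScore μ₁ p.1) *
      (s * scoreDeriv μ₁ p.1 + c * scoreDeriv μ₂ p.2))

theorem measurable_transportKernel (μ₁ μ₂ : Measure ℝ) (c s : ℝ) :
    Measurable (transportKernel μ₁ μ₂ c s) := by
  have a := measurable_density (μ₁ ∗ μ₂)
  have b := measurable_normalScore μ₁
  have b' := measurable_normalScore μ₂
  have d := measurable_scoreDeriv μ₁
  have d' := measurable_scoreDeriv μ₂
  have e := measurable_gaussianPDFReal 0 1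
  unfold transportKernel
  fun_prop

theorem transportKernel_nonneg (μ₁ μ₂ : Measure ℝ) {c s : ℝ} (hc : 0 ≤ c) (hs : 0 ≤ s)
    (p : ℝ × ℝ) : 0 ≤ transportKernel μ₁ μ₂ c s p :=
  mul_nonneg (density_nonneg _ _) (mul_nonneg (gaussianPDFReal_nonneg _ _ _)
    (add_nonneg (mul_nonneg hs (scoreDeriv_nonneg _ _)) (mul_nonneg hc (scoreDeriv_nonneg _ _))))

/-- The transport inequality in the plane: integrate
`lintegral_gaussian_rotatedScore_le_one` against the density of the sum, along the
lines of constant sum. -/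
theorem lintegral_transportKernel_le_one (μ₁ μ₂ : Measure ℝ) [IsProbabilityMeasure μ₁]
    [IsProbabilityMeasure μ₂] (h₁ : μ₁ ≪ volume) (h₂ : μ₂ ≪ volume) {c s : ℝ} (hc : 0 ≤ c)
    (hs : 0 ≤ s) :
    ∫⁻ p in cdfInterval μ₁ ×ˢ cdfInterval μ₂,
      ENNReal.ofReal (transportKernel μ₁ μ₂ c s p) ≤ 1 := by
  have hm1 := (isOpen_cdfInterval h₁).measurableSet
  have hm2 := (isOpen_cdfInterval h₂).measurableSet
  have hfm : Measurable fun p : ℝ × ℝ => (cdfInterval μ₁ ×ˢ cdfInterval μ₂).indicator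
      (fun p => ENNReal.ofReal (transportKernel μ₁ μ₂ c s p)) p :=
    (measurable_transportKernel μ₁ μ₂ c s).ennreal_ofReal.indicator (hm1.prod hm2)
  rw [← lintegral_indicator (hm1.prod hm2), Measure.volume_eq_prod,
    lintegral_prod_symm' _ hfm]
  -- the shear `(x₁, x₂) ↦ (x₁ + x₂, x₂)`
  have hshear : ∀ t : ℝ, ∫⁻ x, (cdfInterval μ₁ ×ˢ cdfInterval μ₂).indicator
      (fun p => ENNReal.ofReal (transportKernel μ₁ μ₂ c s p)) (x, t) =
      ∫⁻ x, (cdfInterval μ₁ ×ˢ cdfInterval μ₂).indicator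
      (fun p => ENNReal.ofReal (transportKernel μ₁ μ₂ c s p)) (x - t, t) := fun t =>
    (lintegral_sub_right_eq_self (fun x => (cdfInterval μ₁ ×ˢ cdfInterval μ₂).indicator
      (fun p => ENNReal.ofReal (transportKernel μ₁ μ₂ c s p)) (x, t)) t).symm
  simp_rw [hshear]
  rw [lintegral_lintegral_swap (by
    apply Measurable.aemeasurable
    exact hfm.comp (by fun_prop : Measurable fun q : ℝ × ℝ => (q.2 - q.1, q.1)))]
  have hinner : ∀ x : ℝ, ∫⁻ t, (cdfInterval μ₁ ×ˢ cdfInterval μ₂).indicator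
      (fun p => ENNReal.ofReal (transportKernel μ₁ μ₂ c s p)) (x - t, t) ≤
      ENNReal.ofReal (density (μ₁ ∗ μ₂) x) := by
    intro x
    have hJm : MeasurableSet {t | x - t ∈ cdfInterval μ₁ ∧ t ∈ cdfInterval μ₂} :=
      (hm1.preimage (by fun_prop)).inter hm2
    calc ∫⁻ t, (cdfInterval μ₁ ×ˢ cdfInterval μ₂).indicator
          (fun p => ENNReal.ofReal (transportKernel μ₁ μ₂ c s p)) (x - t, t)
        = ∫⁻ t in {t | x - t ∈ cdfInterval μ₁ ∧ t ∈ cdfInterval μ₂},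
            ENNReal.ofReal (density (μ₁ ∗ μ₂) x) * ENNReal.ofReal
            (gaussianPDFReal 0 1 (c * normalScore μ₂ t - s * normalScore μ₁ (x - t)) *
            (s * scoreDeriv μ₁ (x - t) + c * scoreDeriv μ₂ t)) := by
          rw [← lintegral_indicator hJm]
          congr 1 with t
          classical
          rw [indicator_apply, indicator_apply]
          refine if_congr Iff.rfl ?_ rfl
          rw [← ENNReal.ofReal_mul (density_nonneg _ _), transportKernel]
          simp only [sub_add_cancel]
      _ = ENNReal.ofReal (density (μ₁ ∗ μ₂) x) *
          ∫⁻ t in {t | x - t ∈ cdfInterval μ₁ ∧ t ∈ cdfInterval μ₂}, ENNReal.ofReal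
            (gaussianPDFReal 0 1 (c * normalScore μ₂ t - s * normalScore μ₁ (x - t)) *
            (s * scoreDeriv μ₁ (x - t) + c * scoreDeriv μ₂ t)) :=
          lintegral_const_mul' _ _ ENNReal.ofReal_ne_top
      _ ≤ ENNReal.ofReal (density (μ₁ ∗ μ₂) x) * 1 := by
          gcongr
          exact lintegral_gaussian_rotatedScore_le_one μ₁ μ₂ h₁ h₂ hc hs x
      _ = _ := mul_one _
  calc _ ≤ ∫⁻ x, ENNReal.ofReal (density (μ₁ ∗ μ₂) x) := lintegral_mono hinner
    _ = (volume.withDensity fun x => ENNReal.ofReal (density (μ₁ ∗ μ₂) x)) univ := by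
        rw [withDensity_apply _ MeasurableSet.univ, Measure.restrict_univ]
    _ = 1 := by rw [withDensity_density (conv_absolutelyContinuous_volume h₂), measure_univ]

/-! ### The Lieb splitting inequality and its equality case -/

theorem log_gaussianPDFReal (x : ℝ) :
    Real.log (gaussianPDFReal 0 1 x) = -Real.log (√(2 * Real.pi)) - x ^ 2 / 2 := by
  have h : (0:ℝ) < √(2 * Real.pi) := by positivity
  rw [gaussianPDFReal, NNReal.coe_one, mul_one, mul_one, Real.log_mul (by positivity)
    (Real.exp_pos _).ne', Real.log_inv, Real.log_exp]
  ring

/-- The likelihood ratio of `transportKernel` against the product law, on the set where both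
densities are positive. -/
noncomputable def transportRatio (μ₁ μ₂ : Measure ℝ) (c s : ℝ) (p : ℝ × ℝ) : ℝ :=
  density (μ₁ ∗ μ₂) (p.1 + p.2) * (c / scoreDeriv μ₁ p.1 + s / scoreDeriv μ₂ p.2) /
    gaussianPDFReal 0 1 (c * normalScore μ₁ p.1 + s * normalScore μ₂ p.2)

theorem measurable_transportRatio (μ₁ μ₂ : Measure ℝ) (c s : ℝ) :
    Measurable (transportRatio μ₁ μ₂ c s) := by
  have a := measurable_density (μ₁ ∗ μ₂)
  have b := measurable_normalScore μ₁
  have b' := measurable_normalScore μ₂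
  have d := measurable_scoreDeriv μ₁
  have d' := measurable_scoreDeriv μ₂
  have e := measurable_gaussianPDFReal 0 1
  unfold transportRatio
  fun_prop

/-- The rotation invariance of the standard normal density. -/
theorem gaussianPDFReal_rotation {c s : ℝ} (hcs : c ^ 2 + s ^ 2 = 1) (a b : ℝ) :
    gaussianPDFReal 0 1 a * gaussianPDFReal 0 1 b =
      gaussianPDFReal 0 1 (c * a + s * b) * gaussianPDFReal 0 1 (c * b - s * a) := by
  have h : ∀ x, 0 < gaussianPDFReal 0 1 x := fun x => gaussianPDFReal_pos 0 1 x one_ne_zero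
  apply Real.log_injOn_pos (mul_pos (h _) (h _)) (mul_pos (h _) (h _))
  rw [Real.log_mul (h _).ne' (h _).ne', Real.log_mul (h _).ne' (h _).ne']
  simp only [log_gaussianPDFReal]
  linear_combination (a ^ 2 + b ^ 2) / 2 * hcs

/-- The change of variables `f₁ f₂ = φ(z) φ(w) S₁' S₂'` turns the kernel into the density of the
product law times the ratio. -/
theorem transportKernel_eq_mul_transportRatio (μ₁ μ₂ : Measure ℝ) {c s : ℝ}
    (hcs : c ^ 2 + s ^ 2 = 1) {p : ℝ × ℝ} (hp₁ : 0 < scoreDeriv μ₁ p.1)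
    (hp₂ : 0 < scoreDeriv μ₂ p.2) :
    transportKernel μ₁ μ₂ c s p =
      density μ₁ p.1 * density μ₂ p.2 * transportRatio μ₁ μ₂ c s p := by
  have hz : 0 < gaussianPDFReal 0 1 (c * normalScore μ₁ p.1 + s * normalScore μ₂ p.2) :=
    gaussianPDFReal_pos 0 1 _ one_ne_zero
  have hr := gaussianPDFReal_rotation hcs (normalScore μ₁ p.1) (normalScore μ₂ p.2)
  rw [transportKernel, transportRatio, density_eq_scoreDeriv μ₁, density_eq_scoreDeriv μ₂]
  rw [mul_mul_mul_comm, hr]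
  set Z := gaussianPDFReal 0 1 (c * normalScore μ₁ p.1 + s * normalScore μ₂ p.2)
  field_simp
  ring

theorem scoreDeriv_pos_iff (μ : Measure ℝ) (x : ℝ) : 0 < scoreDeriv μ x ↔ 0 < density μ x := by
  rw [scoreDeriv, div_pos_iff_of_pos_right (gaussianPDFReal_pos 0 1 _ one_ne_zero)]

theorem ofReal_mul_transportRatio_le (μ₁ μ₂ : Measure ℝ) {c s : ℝ} (hcs : c ^ 2 + s ^ 2 = 1)
    (p : ℝ × ℝ) :
    ENNReal.ofReal (density μ₁ p.1) * ENNReal.ofReal (density μ₂ p.2) *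
      ENNReal.ofReal (transportRatio μ₁ μ₂ c s p) ≤
    ENNReal.ofReal (transportKernel μ₁ μ₂ c s p) := by
  rcases (density_nonneg μ₁ p.1).eq_or_lt with h | h
  · simp [← h]
  rcases (density_nonneg μ₂ p.2).eq_or_lt with h' | h'
  · simp [← h']
  rw [transportKernel_eq_mul_transportRatio μ₁ μ₂ hcs ((scoreDeriv_pos_iff _ _).2 h)
    ((scoreDeriv_pos_iff _ _).2 h'), ENNReal.ofReal_mul (by positivity), ENNReal.ofReal_mul h.le]

theorem lintegral_transportRatio_eq (μ₁ μ₂ : Measure ℝ) [IsProbabilityMeasure μ₁]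
    [IsProbabilityMeasure μ₂] (h₁ : μ₁ ≪ volume) (h₂ : μ₂ ≪ volume) (c s : ℝ) :
    ∫⁻ p, ENNReal.ofReal (transportRatio μ₁ μ₂ c s p) ∂(μ₁.prod μ₂) =
      ∫⁻ p in cdfInterval μ₁ ×ˢ cdfInterval μ₂,
        ENNReal.ofReal (density μ₁ p.1) * ENNReal.ofReal (density μ₂ p.2) *
          ENNReal.ofReal (transportRatio μ₁ μ₂ c s p) := by
  have hm1 := (isOpen_cdfInterval h₁).measurableSet
  have hm2 := (isOpen_cdfInterval h₂).measurableSet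
  have hae : ∀ᵐ p ∂(μ₁.prod μ₂), p ∈ cdfInterval μ₁ ×ˢ cdfInterval μ₂ := by
    filter_upwards [Measure.quasiMeasurePreserving_fst.ae (mem_cdfInterval_ae h₁),
      Measure.quasiMeasurePreserving_snd.ae (mem_cdfInterval_ae h₂)] with p hp hp'
    exact ⟨hp, hp'⟩
  have hprod : μ₁.prod μ₂ = (volume : Measure (ℝ × ℝ)).withDensity fun p =>
      ENNReal.ofReal (density μ₁ p.1) * ENNReal.ofReal (density μ₂ p.2) := by
    conv_lhs => rw [← withDensity_density h₁, ← withDensity_density h₂]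
    rw [prod_withDensity (measurable_density μ₁).ennreal_ofReal
      (measurable_density μ₂).ennreal_ofReal, Measure.volume_eq_prod]
  have hae' : (cdfInterval μ₁ ×ˢ cdfInterval μ₂ : Set (ℝ × ℝ)) =ᵐ[μ₁.prod μ₂] univ :=
    eventuallyEq_univ.2 hae
  rw [← setLIntegral_univ, ← setLIntegral_congr hae', hprod,
    setLIntegral_withDensity_eq_setLIntegral_mul _ _ _ (hm1.prod hm2)]
  · rfl
  · have a := measurable_density μ₁
    have b := measurable_density μ₂
    fun_prop
  · exact (measurable_transportRatio _ _ _ _).ennreal_ofReal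

theorem lintegral_transportRatio_le_one (μ₁ μ₂ : Measure ℝ) [IsProbabilityMeasure μ₁]
    [IsProbabilityMeasure μ₂] (h₁ : μ₁ ≪ volume) (h₂ : μ₂ ≪ volume) {c s : ℝ} (hc : 0 ≤ c)
    (hs : 0 ≤ s) (hcs : c ^ 2 + s ^ 2 = 1) :
    ∫⁻ p, ENNReal.ofReal (transportRatio μ₁ μ₂ c s p) ∂(μ₁.prod μ₂) ≤ 1 := by
  rw [lintegral_transportRatio_eq μ₁ μ₂ h₁ h₂]
  exact (lintegral_mono fun p => ofReal_mul_transportRatio_le μ₁ μ₂ hcs p).trans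
    (lintegral_transportKernel_le_one μ₁ μ₂ h₁ h₂ hc hs)

/-- The differential entropy of a law on the line. -/
noncomputable def entropy (μ : Measure ℝ) : ℝ := -∫ x, Real.log (density μ x) ∂μ

/-- A lower bound for the logarithm of `transportRatio` whose expectation is the negative of the
deficit in the Lieb splitting inequality. -/
noncomputable def splittingLog (μ₁ μ₂ : Measure ℝ) (c s : ℝ) (p : ℝ × ℝ) : ℝ :=
  Real.log (density (μ₁ ∗ μ₂) (p.1 + p.2)) - c ^ 2 * (Real.log c + Real.log (density μ₁ p.1)) -
    s ^ 2 * (Real.log s + Real.log (density μ₂ p.2)) +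
    c * s * (normalScore μ₁ p.1 * normalScore μ₂ p.2)

theorem splittingLog_eq (μ₁ μ₂ : Measure ℝ) {c s : ℝ} (hc : 0 < c) (hs : 0 < s)
    (hcs : c ^ 2 + s ^ 2 = 1) {p : ℝ × ℝ} (hp₁ : 0 < scoreDeriv μ₁ p.1)
    (hp₂ : 0 < scoreDeriv μ₂ p.2) :
    splittingLog μ₁ μ₂ c s p = Real.log (density (μ₁ ∗ μ₂) (p.1 + p.2)) +
      (c ^ 2 * Real.log (c * scoreDeriv μ₁ p.1)⁻¹ + s ^ 2 * Real.log (s * scoreDeriv μ₂ p.2)⁻¹) -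
      Real.log (gaussianPDFReal 0 1 (c * normalScore μ₁ p.1 + s * normalScore μ₂ p.2)) := by
  have h : ∀ x, gaussianPDFReal 0 1 x ≠ 0 := fun x => (gaussianPDFReal_pos 0 1 x one_ne_zero).ne'
  rw [splittingLog, density_eq_scoreDeriv μ₁, density_eq_scoreDeriv μ₂, Real.log_inv,
    Real.log_inv, Real.log_mul (h _) hp₁.ne', Real.log_mul (h _) hp₂.ne',
    Real.log_mul hc.ne' hp₁.ne', Real.log_mul hs.ne' hp₂.ne']
  simp only [log_gaussianPDFReal]
  linear_combination Real.log (√(2 * Real.pi)) * hcs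

theorem log_transportRatio_eq (μ₁ μ₂ : Measure ℝ) {c s : ℝ} (hc : 0 < c) (hs : 0 < s)
    {p : ℝ × ℝ} (hp₁ : 0 < scoreDeriv μ₁ p.1)
    (hp₂ : 0 < scoreDeriv μ₂ p.2) (hp : 0 < density (μ₁ ∗ μ₂) (p.1 + p.2)) :
    0 < transportRatio μ₁ μ₂ c s p ∧ Real.log (transportRatio μ₁ μ₂ c s p) =
      Real.log (density (μ₁ ∗ μ₂) (p.1 + p.2)) +
      Real.log (c ^ 2 * (c * scoreDeriv μ₁ p.1)⁻¹ + s ^ 2 * (s * scoreDeriv μ₂ p.2)⁻¹) -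
      Real.log (gaussianPDFReal 0 1 (c * normalScore μ₁ p.1 + s * normalScore μ₂ p.2)) := by
  have h := gaussianPDFReal_pos 0 1 (c * normalScore μ₁ p.1 + s * normalScore μ₂ p.2) one_ne_zero
  have e : c / scoreDeriv μ₁ p.1 + s / scoreDeriv μ₂ p.2 =
      c ^ 2 * (c * scoreDeriv μ₁ p.1)⁻¹ + s ^ 2 * (s * scoreDeriv μ₂ p.2)⁻¹ := by
    field_simp
  have hpos : 0 < c / scoreDeriv μ₁ p.1 + s / scoreDeriv μ₂ p.2 := by positivity
  refine ⟨by rw [transportRatio]; positivity, ?_⟩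
  rw [transportRatio, Real.log_div (by positivity) h.ne', Real.log_mul hp.ne' hpos.ne', e]

/-- The weighted arithmetic-geometric mean inequality in logarithmic form. -/
theorem splittingLog_le_log_transportRatio (μ₁ μ₂ : Measure ℝ) {c s : ℝ} (hc : 0 < c) (hs : 0 < s)
    (hcs : c ^ 2 + s ^ 2 = 1) {p : ℝ × ℝ} (hp₁ : 0 < scoreDeriv μ₁ p.1)
    (hp₂ : 0 < scoreDeriv μ₂ p.2) (hp : 0 < density (μ₁ ∗ μ₂) (p.1 + p.2)) :
    splittingLog μ₁ μ₂ c s p ≤ Real.log (transportRatio μ₁ μ₂ c s p) := by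
  rw [splittingLog_eq μ₁ μ₂ hc hs hcs hp₁ hp₂, (log_transportRatio_eq μ₁ μ₂ hc hs hp₁ hp₂ hp).2]
  gcongr
  exact strictConcaveOn_log_Ioi.concaveOn.2
    (mem_Ioi.2 (by positivity : 0 < (c * scoreDeriv μ₁ p.1)⁻¹))
    (mem_Ioi.2 (by positivity : 0 < (s * scoreDeriv μ₂ p.2)⁻¹)) (by positivity) (by positivity) hcs

/-- The equality case of `splittingLog_le_log_transportRatio`, by strict concavity of the
logarithm. -/
theorem mul_scoreDeriv_eq_of_log_transportRatio_le (μ₁ μ₂ : Measure ℝ) {c s : ℝ} (hc : 0 < c)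
    (hs : 0 < s) (hcs : c ^ 2 + s ^ 2 = 1) {p : ℝ × ℝ} (hp₁ : 0 < scoreDeriv μ₁ p.1)
    (hp₂ : 0 < scoreDeriv μ₂ p.2) (hp : 0 < density (μ₁ ∗ μ₂) (p.1 + p.2))
    (hle : Real.log (transportRatio μ₁ μ₂ c s p) ≤ splittingLog μ₁ μ₂ c s p) :
    c * scoreDeriv μ₁ p.1 = s * scoreDeriv μ₂ p.2 := by
  rw [splittingLog_eq μ₁ μ₂ hc hs hcs hp₁ hp₂,
    (log_transportRatio_eq μ₁ μ₂ hc hs hp₁ hp₂ hp).2] at hle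
  by_contra hne
  have := strictConcaveOn_log_Ioi.2 (mem_Ioi.2 (by positivity : 0 < (c * scoreDeriv μ₁ p.1)⁻¹))
    (mem_Ioi.2 (by positivity : 0 < (s * scoreDeriv μ₂ p.2)⁻¹)) (fun h => hne (inv_injective h))
    (by positivity : 0 < c ^ 2) (by positivity : 0 < s ^ 2) hcs
  simp only [smul_eq_mul] at this
  linarith

theorem integrable_normalScore {μ : Measure ℝ} [IsProbabilityMeasure μ] (hμ : μ ≪ volume) :
    Integrable (normalScore μ) μ := by
  have h : Integrable (fun x : ℝ => x) (μ.map (normalScore μ)) := by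
    rw [map_normalScore hμ]
    exact (memLp_id_gaussianReal 1).integrable le_rfl
  exact h.comp_measurable (measurable_normalScore μ)

theorem integral_normalScore {μ : Measure ℝ} [IsProbabilityMeasure μ] (hμ : μ ≪ volume) :
    ∫ x, normalScore μ x ∂μ = 0 := by
  have h := integral_map (μ := μ) (measurable_normalScore μ).aemeasurable
    (f := fun x : ℝ => x) measurable_id.aestronglyMeasurable
  rw [← h, map_normalScore hμ, integral_id_gaussianReal]

theorem integrable_log_density_add {μ₁ μ₂ : Measure ℝ}
    (i : Integrable (fun x => Real.log (density (μ₁ ∗ μ₂) x)) (μ₁ ∗ μ₂)) :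
    Integrable (fun p : ℝ × ℝ => Real.log (density (μ₁ ∗ μ₂) (p.1 + p.2))) (μ₁.prod μ₂) :=
  i.comp_measurable (f := fun p : ℝ × ℝ => p.1 + p.2) (by fun_prop)

section Splitting

variable {μ₁ μ₂ : Measure ℝ} [IsProbabilityMeasure μ₁] [IsProbabilityMeasure μ₂] {c s : ℝ}

theorem integrable_splittingLog (h₁ : μ₁ ≪ volume) (h₂ : μ₂ ≪ volume)
    (i₁ : Integrable (fun x => Real.log (density μ₁ x)) μ₁)
    (i₂ : Integrable (fun x => Real.log (density μ₂ x)) μ₂)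
    (i : Integrable (fun x => Real.log (density (μ₁ ∗ μ₂) x)) (μ₁ ∗ μ₂)) :
    Integrable (splittingLog μ₁ μ₂ c s) (μ₁.prod μ₂) :=
  ((integrable_log_density_add i).sub (((integrable_const _).add (i₁.comp_fst μ₂)).const_mul _)
    |>.sub (((integrable_const _).add (i₂.comp_snd μ₁)).const_mul _)).add
    (((integrable_normalScore h₁).mul_prod (integrable_normalScore h₂)).const_mul _)

/-- The score term drops out since the scores are independent and centered. -/
theorem integral_splittingLog (h₁ : μ₁ ≪ volume) (h₂ : μ₂ ≪ volume)
    (i₁ : Integrable (fun x => Real.log (density μ₁ x)) μ₁)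
    (i₂ : Integrable (fun x => Real.log (density μ₂ x)) μ₂)
    (i : Integrable (fun x => Real.log (density (μ₁ ∗ μ₂) x)) (μ₁ ∗ μ₂)) :
    ∫ p, splittingLog μ₁ μ₂ c s p ∂(μ₁.prod μ₂) =
      c ^ 2 * (entropy μ₁ - Real.log c) + s ^ 2 * (entropy μ₂ - Real.log s) -
        entropy (μ₁ ∗ μ₂) := by
  have e : ∫ p : ℝ × ℝ, Real.log (density (μ₁ ∗ μ₂) (p.1 + p.2)) ∂(μ₁.prod μ₂) =
      ∫ x, Real.log (density (μ₁ ∗ μ₂) x) ∂(μ₁ ∗ μ₂) := by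
    rw [Measure.conv, integral_map (by fun_prop)]
    exact ((measurable_density _).log).aestronglyMeasurable
  have e₁ : ∫ p : ℝ × ℝ, (Real.log c + Real.log (density μ₁ p.1)) ∂(μ₁.prod μ₂) =
      Real.log c - entropy μ₁ := by
    rw [integral_add (integrable_const _) (i₁.comp_fst μ₂), integral_const,
      integral_fun_fst (fun x => Real.log (density μ₁ x)), entropy]
    simp
  have e₂ : ∫ p : ℝ × ℝ, (Real.log s + Real.log (density μ₂ p.2)) ∂(μ₁.prod μ₂) =
      Real.log s - entropy μ₂ := by
    rw [integral_add (integrable_const _) (i₂.comp_snd μ₁), integral_const,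
      integral_fun_snd (fun x => Real.log (density μ₂ x)), entropy]
    simp
  have e₃ : ∫ p : ℝ × ℝ, normalScore μ₁ p.1 * normalScore μ₂ p.2 ∂(μ₁.prod μ₂) = 0 := by
    rw [integral_prod_mul, integral_normalScore h₁, zero_mul]
  have j := integrable_log_density_add i
  have j₁ : Integrable (fun p : ℝ × ℝ => c ^ 2 * (Real.log c + Real.log (density μ₁ p.1)))
      (μ₁.prod μ₂) := ((integrable_const (Real.log c)).add (i₁.comp_fst μ₂)).const_mul (c ^ 2)
  have j₂ : Integrable (fun p : ℝ × ℝ => s ^ 2 * (Real.log s + Real.log (density μ₂ p.2)))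
      (μ₁.prod μ₂) := ((integrable_const (Real.log s)).add (i₂.comp_snd μ₁)).const_mul (s ^ 2)
  have j₃ := ((integrable_normalScore h₁).mul_prod (integrable_normalScore h₂)).const_mul (c * s)
  have k := integral_add ((j.sub j₁).sub j₂) j₃
  have k' := integral_sub (j.sub j₁) j₂
  have k'' := integral_sub j j₁
  simp only [Pi.sub_apply] at k k' k''
  unfold splittingLog
  rw [k, k', k'',
    integral_const_mul, integral_const_mul, integral_const_mul, e, e₁, e₂, e₃]
  simp only [entropy]
  ring

theorem scoreDeriv_pos_ae (h₁ : μ₁ ≪ volume) (h₂ : μ₂ ≪ volume) :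
    ∀ᵐ p ∂(μ₁.prod μ₂), 0 < scoreDeriv μ₁ p.1 ∧ 0 < scoreDeriv μ₂ p.2 ∧
      0 < density (μ₁ ∗ μ₂) (p.1 + p.2) := by
  have h3 : ∀ᵐ p ∂(μ₁.prod μ₂), 0 < density (μ₁ ∗ μ₂) (p.1 + p.2) := by
    have := density_pos_ae (conv_absolutelyContinuous_volume (μ₁ := μ₁) h₂)
    rw [Measure.conv] at this ⊢
    exact ae_of_ae_map (f := fun p : ℝ × ℝ => p.1 + p.2) (by fun_prop) this
  filter_upwards [Measure.quasiMeasurePreserving_fst.ae (density_pos_ae h₁),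
    Measure.quasiMeasurePreserving_snd.ae (density_pos_ae h₂), h3] with p hp hp' hp''
  exact ⟨(scoreDeriv_pos_iff _ _).2 hp, (scoreDeriv_pos_iff _ _).2 hp', hp''⟩

theorem integrable_transportRatio (h₁ : μ₁ ≪ volume) (h₂ : μ₂ ≪ volume) (hc : 0 < c) (hs : 0 < s)
    (hcs : c ^ 2 + s ^ 2 = 1) :
    Integrable (transportRatio μ₁ μ₂ c s) (μ₁.prod μ₂) ∧
      ∫ p, transportRatio μ₁ μ₂ c s p ∂(μ₁.prod μ₂) ≤ 1 := by
  have hle := lintegral_transportRatio_le_one μ₁ μ₂ h₁ h₂ hc.le hs.le hcs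
  have hnn : 0 ≤ᵐ[μ₁.prod μ₂] transportRatio μ₁ μ₂ c s := by
    filter_upwards [scoreDeriv_pos_ae h₁ h₂] with p hp
    exact (log_transportRatio_eq μ₁ μ₂ hc hs hp.1 hp.2.1 hp.2.2).1.le
  have hm := (measurable_transportRatio μ₁ μ₂ c s).aestronglyMeasurable (μ := μ₁.prod μ₂)
  refine ⟨⟨hm, ?_⟩, ?_⟩
  · rw [hasFiniteIntegral_iff_ofReal hnn]
    exact hle.trans_lt ENNReal.one_lt_top
  · rw [integral_eq_lintegral_of_nonneg_ae hnn hm]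
    exact ENNReal.toReal_le_of_le_ofReal zero_le_one (by simpa using hle)

theorem splittingLog_le_transportRatio_sub_one_ae (h₁ : μ₁ ≪ volume) (h₂ : μ₂ ≪ volume)
    (hc : 0 < c) (hs : 0 < s) (hcs : c ^ 2 + s ^ 2 = 1) :
    ∀ᵐ p ∂(μ₁.prod μ₂), splittingLog μ₁ μ₂ c s p ≤ transportRatio μ₁ μ₂ c s p - 1 := by
  filter_upwards [scoreDeriv_pos_ae h₁ h₂] with p hp
  exact (splittingLog_le_log_transportRatio μ₁ μ₂ hc hs hcs hp.1 hp.2.1 hp.2.2).trans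
    (Real.log_le_sub_one_of_pos (log_transportRatio_eq μ₁ μ₂ hc hs hp.1 hp.2.1 hp.2.2).1)

/-- The expectation of `splittingLog` is at most that of `transportRatio - 1`, which is at most
zero; this is the Lieb splitting inequality. In the equality case the bound `log u ≤ u - 1` and the
arithmetic-geometric mean inequality are equalities almost everywhere. -/
theorem ae_of_lieb_splitting_eq (h₁ : μ₁ ≪ volume) (h₂ : μ₂ ≪ volume)
    (i₁ : Integrable (fun x => Real.log (density μ₁ x)) μ₁)
    (i₂ : Integrable (fun x => Real.log (density μ₂ x)) μ₂)
    (i : Integrable (fun x => Real.log (density (μ₁ ∗ μ₂) x)) (μ₁ ∗ μ₂))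
    (hc : 0 < c) (hs : 0 < s) (hcs : c ^ 2 + s ^ 2 = 1)
    (heq : entropy (μ₁ ∗ μ₂) ≤
      c ^ 2 * (entropy μ₁ - Real.log c) + s ^ 2 * (entropy μ₂ - Real.log s)) :
    ∀ᵐ p ∂(μ₁.prod μ₂), transportRatio μ₁ μ₂ c s p = 1 ∧
      c * scoreDeriv μ₁ p.1 = s * scoreDeriv μ₂ p.2 := by
  obtain ⟨j, hj⟩ := integrable_transportRatio h₁ h₂ hc hs hcs
  have hl := integrable_splittingLog (c := c) (s := s) h₁ h₂ i₁ i₂ i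
  have hle := splittingLog_le_transportRatio_sub_one_ae h₁ h₂ hc hs hcs
  have hj1 : Integrable (fun p => transportRatio μ₁ μ₂ c s p - 1) (μ₁.prod μ₂) :=
    j.sub (integrable_const 1)
  have hae : splittingLog μ₁ μ₂ c s =ᵐ[μ₁.prod μ₂] fun p => transportRatio μ₁ μ₂ c s p - 1 := by
    refine (integral_eq_iff_of_ae_le hl hj1 hle).1 (le_antisymm (integral_mono_ae hl hj1 hle) ?_)
    rw [integral_splittingLog h₁ h₂ i₁ i₂ i, integral_sub j (integrable_const 1), integral_const]
    simp only [probReal_univ, smul_eq_mul, mul_one]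
    linarith
  filter_upwards [hae, scoreDeriv_pos_ae h₁ h₂] with p hp hpos
  obtain ⟨hu, -⟩ := log_transportRatio_eq μ₁ μ₂ hc hs hpos.1 hpos.2.1 hpos.2.2
  have k1 := splittingLog_le_log_transportRatio μ₁ μ₂ hc hs hcs hpos.1 hpos.2.1 hpos.2.2
  have k2 := Real.log_le_sub_one_of_pos hu
  refine ⟨?_, mul_scoreDeriv_eq_of_log_transportRatio_le μ₁ μ₂ hc hs hcs hpos.1 hpos.2.1 hpos.2.2
    (k2.trans hp.ge)⟩
  by_contra hne
  have := Real.log_lt_sub_one_of_pos hu hne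
  linarith

/-- In the equality case the transport kernel carries no mass where one of the densities
vanishes. -/
theorem transportKernel_ae_of_lieb_splitting_eq (h₁ : μ₁ ≪ volume) (h₂ : μ₂ ≪ volume)
    (hc : 0 < c) (hs : 0 < s) (hcs : c ^ 2 + s ^ 2 = 1)
    (h : ∀ᵐ p ∂(μ₁.prod μ₂), transportRatio μ₁ μ₂ c s p = 1) :
    ∀ᵐ p : ℝ × ℝ, p.1 ∈ cdfInterval μ₁ → p.2 ∈ cdfInterval μ₂ →
      density μ₁ p.1 = 0 ∨ density μ₂ p.2 = 0 → transportKernel μ₁ μ₂ c s p = 0 := by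
  have hm := ((isOpen_cdfInterval h₁).measurableSet.prod (isOpen_cdfInterval h₂).measurableSet)
  have hint : ∫⁻ p, ENNReal.ofReal (transportRatio μ₁ μ₂ c s p) ∂(μ₁.prod μ₂) = 1 := by
    have : (fun p => ENNReal.ofReal (transportRatio μ₁ μ₂ c s p)) =ᵐ[μ₁.prod μ₂] fun _ => 1 := by
      filter_upwards [h] with p hp
      rw [hp, ENNReal.ofReal_one]
    rw [lintegral_congr_ae this]
    simp
  have hle := lintegral_transportKernel_le_one μ₁ μ₂ h₁ h₂ hc.le hs.le
  rw [lintegral_transportRatio_eq μ₁ μ₂ h₁ h₂] at hint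
  have hae := ae_eq_of_ae_le_of_lintegral_le (μ := volume.restrict
    (cdfInterval μ₁ ×ˢ cdfInterval μ₂))
    (ae_of_all _ fun p => ofReal_mul_transportRatio_le μ₁ μ₂ hcs p)
    (by rw [hint]; exact ENNReal.one_ne_top)
    (measurable_transportKernel μ₁ μ₂ c s).ennreal_ofReal.aemeasurable (by rw [hint]; exact hle)
  rw [EventuallyEq, ae_restrict_iff' hm] at hae
  filter_upwards [hae] with p hp hp1 hp2 h0
  have := hp ⟨hp1, hp2⟩
  have h0' : ENNReal.ofReal (density μ₁ p.1) * ENNReal.ofReal (density μ₂ p.2) = 0 := by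
    rcases h0 with h0 | h0 <;> simp [h0]
  rw [h0', zero_mul] at this
  exact le_antisymm (ENNReal.ofReal_eq_zero.1 this.symm)
    (transportKernel_nonneg μ₁ μ₂ hc.le hs.le p)

end Splitting

/-- If translates of a set `A` of positive measure by points of `Q` lie in `E`, and by points of
`B` lie outside `E`, up to null sets, then `Q` and `B` are separated by a positive distance. -/
theorem exists_separation_of_translates {A Q B E : Set ℝ} (hA : MeasurableSet A)
    (hA0 : volume A ≠ 0) (hQ : ∀ y ∈ Q, ∀ᵐ x, x ∈ A → x + y ∈ E)
    (hB : ∀ y ∈ B, ∀ᵐ x, x ∈ A → x + y ∉ E) :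
    ∃ η > 0, ∀ q ∈ Q, ∀ b ∈ B, η ≤ dist b q := by
  obtain ⟨k, hkA, hk, hk0⟩ := hA.exists_lt_isCompact (pos_iff_ne_zero.2 hA0)
  have ht := tendsto_measure_vadd_sdiff_isCompact_isClosed (μ := (volume : Measure ℝ)) hk
    hk.isClosed
  obtain ⟨η, hη, hball⟩ := Metric.eventually_nhds_iff.1 (ht.eventually (gt_mem_nhds hk0))
  refine ⟨η, hη, fun q hq b hb => ?_⟩
  by_contra! hlt
  have hlt' := hball (y := b - q) (by rwa [dist_zero_right, ← dist_eq_norm])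
  have hvol : volume ((b - q) +ᵥ k) = volume k := measure_vadd _ _ _
  have hnull : volume (((b - q) +ᵥ k) ∩ k) = 0 := by
    refine measure_eq_zero_iff_ae_notMem.2 ?_
    have e := (measurePreserving_sub_right volume (b - q)).quasiMeasurePreserving.ae (hB b hb)
    filter_upwards [hQ q hq, e] with x hx hx' hmem
    obtain ⟨⟨x', hx'k, rfl⟩, hxk⟩ := hmem
    simp only [vadd_eq_add, add_sub_cancel_left] at hx hx' hxk
    have e1 := hx' (hkA hx'k)
    have e2 := hx (hkA hxk)
    rw [show b - q + x' + q = x' + b by ring] at e2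
    exact e1 e2
  have := measure_inter_add_sdiff (μ := volume) ((b - q) +ᵥ k) hk.measurableSet
  rw [hnull, zero_add, hvol] at this
  exact hlt'.ne this

/-- An open interval covered by two sets of which the first is not null, such that almost all
points of the sets are at a positive distance, is covered by the first set alone, up to a
null set. -/
theorem null_of_separated {I Q B : Set ℝ} (hI : IsOpen I) (hIc : IsPreconnected I)
    (hcov : I ⊆ Q ∪ B) (hQ0 : volume (Q ∩ I) ≠ 0) {Q' B' : Set ℝ} (hQ' : ∀ᵐ x, x ∈ Q → x ∈ Q')
    (hB' : ∀ᵐ x, x ∈ B → x ∈ B')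
    (hsep : ∃ η > 0, ∀ q ∈ Q', ∀ b ∈ B', η ≤ dist b q) : volume (B ∩ I) = 0 := by
  obtain ⟨η, hη, hd⟩ := hsep
  set U : Set ℝ := {x | ∀ᶠ N in (𝓝 x).smallSets, volume (B ∩ N) = 0} with hU
  set V : Set ℝ := {x | ∀ᶠ N in (𝓝 x).smallSets, volume (Q ∩ N) = 0} with hV
  have key : ∀ (C : Set ℝ) (x : ℝ), (∀ᶠ N in (𝓝 x).smallSets, volume (C ∩ N) = 0) ↔
      ∃ N ∈ 𝓝 x, volume (C ∩ N) = 0 := fun C x =>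
    eventually_smallSets' fun s t hst ht => measure_mono_null (inter_subset_inter_right C hst) ht
  have hopen : ∀ C : Set ℝ, IsOpen {x | ∀ᶠ N in (𝓝 x).smallSets, volume (C ∩ N) = 0} := by
    intro C
    refine isOpen_iff_mem_nhds.2 fun x hx => ?_
    obtain ⟨N, hN, hN0⟩ := (key C x).1 hx
    filter_upwards [eventually_mem_nhds_iff.2 hN] with y hy
    exact (key C y).2 ⟨N, hy, hN0⟩
  have hdisj : Disjoint (U ∩ I) (V ∩ I) := by
    refine Set.disjoint_left.2 fun x hx hx' => ?_
    obtain ⟨N, hN, hN0⟩ := (key B x).1 hx.1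
    obtain ⟨M, hM, hM0⟩ := (key Q x).1 hx'.1
    have hpos := Measure.measure_pos_of_mem_nhds volume
      (inter_mem (inter_mem hN hM) (hI.mem_nhds hx.2))
    refine hpos.ne' (measure_mono_null ?_ (measure_union_null hN0 hM0))
    rintro y ⟨⟨hyN, hyM⟩, hyI⟩
    rcases hcov hyI with h | h
    · exact Or.inr ⟨h, hyM⟩
    · exact Or.inl ⟨h, hyN⟩
  have hsub : I ⊆ U ∩ I ∪ V ∩ I := by
    intro x hx
    by_contra hcon
    simp only [mem_union, mem_inter_iff, hx, and_true, not_or] at hcon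
    have hb : ∀ (C C' : Set ℝ), (∀ᵐ y, y ∈ C → y ∈ C') →
        (¬ ∀ᶠ N in (𝓝 x).smallSets, volume (C ∩ N) = 0) →
        ∃ y ∈ C', y ∈ Metric.ball x (η / 2) := by
      intro C C' hC hn
      by_contra! hne
      refine hn ((key C x).2 ⟨_, Metric.ball_mem_nhds x (half_pos hη), ?_⟩)
      refine measure_eq_zero_iff_ae_notMem.2 ?_
      filter_upwards [hC] with y hy hmem using hne y (hy hmem.1) hmem.2
    obtain ⟨b, hb1, hb2⟩ := hb B B' hB' hcon.1
    obtain ⟨q, hq1, hq2⟩ := hb Q Q' hQ' hcon.2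
    have h1 := hd q hq1 b hb1
    have h2 := dist_triangle_right b q x
    rw [Metric.mem_ball] at hb2 hq2
    linarith
  have hnull : ∀ C : Set ℝ, (I ⊆ {x | ∀ᶠ N in (𝓝 x).smallSets, volume (C ∩ N) = 0}) →
      volume (C ∩ I) = 0 := by
    intro C hC
    refine measure_null_of_locally_null _ fun x hx => ?_
    obtain ⟨N, hN, hN0⟩ := (key C x).1 (hC hx.2)
    exact ⟨C ∩ I ∩ N, inter_mem_nhdsWithin _ hN,
      measure_mono_null (inter_subset_inter_left N inter_subset_left) hN0⟩
  have hne : (I ∩ (U ∩ I)).Nonempty := by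
    by_contra hemp
    refine hQ0 (hnull Q fun x hx => ?_)
    rcases hsub hx with h | h
    · exact absurd ⟨x, hx, h⟩ hemp
    · exact h.1
  exact hnull B fun x hx =>
    (hIc.subset_left_of_subset_union ((hopen B).inter hI) ((hopen Q).inter hI) hdisj hsub hne hx).1

theorem ae_of_ae_density_pos {μ : Measure ℝ} [IsProbabilityMeasure μ] (hμ : μ ≪ volume)
    {p : ℝ → Prop} (h : ∀ᵐ x ∂μ, p x) : ∀ᵐ x, 0 < density μ x → p x := by
  rw [← withDensity_density hμ, ae_withDensity_iff (measurable_density μ).ennreal_ofReal] at h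
  filter_upwards [h] with x hx hpos
  exact hx (ENNReal.ofReal_pos.2 hpos).ne'

theorem ae_of_ae_density_pos_prod {μ₁ μ₂ : Measure ℝ} [IsProbabilityMeasure μ₁]
    [IsProbabilityMeasure μ₂] (h₁ : μ₁ ≪ volume) (h₂ : μ₂ ≪ volume)
    {p : ℝ × ℝ → Prop} (h : ∀ᵐ x ∂(μ₁.prod μ₂), p x) :
    ∀ᵐ x : ℝ × ℝ, 0 < density μ₁ x.1 → 0 < density μ₂ x.2 → p x := by
  have a := measurable_density μ₁
  have b := measurable_density μ₂
  rw [← withDensity_density h₁, ← withDensity_density h₂,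
    prod_withDensity a.ennreal_ofReal b.ennreal_ofReal, ae_withDensity_iff (by fun_prop)] at h
  rw [Measure.volume_eq_prod]
  filter_upwards [h] with x hx hpos hpos'
  exact hx (mul_ne_zero (ENNReal.ofReal_pos.2 hpos).ne' (ENNReal.ofReal_pos.2 hpos').ne')

/-- If the sum `x₁ + x₂` lands in `E` when both densities are positive, and outside `E` when only
the first is, then the second density is positive almost everywhere on its interval. -/
theorem density_pos_ae_cdfInterval {μ₁ μ₂ : Measure ℝ} [IsProbabilityMeasure μ₁]
    [IsProbabilityMeasure μ₂] (h₁ : μ₁ ≪ volume) (h₂ : μ₂ ≪ volume) {E : Set ℝ}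
    (hE : ∀ᵐ p : ℝ × ℝ, 0 < density μ₁ p.1 → 0 < density μ₂ p.2 → p.1 + p.2 ∈ E)
    (hE' : ∀ᵐ p : ℝ × ℝ, p.1 ∈ cdfInterval μ₁ → p.2 ∈ cdfInterval μ₂ → 0 < density μ₁ p.1 →
      density μ₂ p.2 = 0 → p.1 + p.2 ∉ E) :
    ∀ᵐ y, y ∈ cdfInterval μ₂ → 0 < density μ₂ y := by
  have hsw : ∀ {r : ℝ × ℝ → Prop}, (∀ᵐ p : ℝ × ℝ, r p) → ∀ᵐ y : ℝ, ∀ᵐ x : ℝ, r (x, y) := by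
    intro r hr
    refine Measure.ae_ae_of_ae_prod (p := fun q : ℝ × ℝ => r (q.2, q.1)) ?_
    rw [Measure.volume_eq_prod] at hr
    exact (Measure.measurePreserving_swap (μ := (volume : Measure ℝ))
      (ν := (volume : Measure ℝ))).quasiMeasurePreserving.ae hr
  have hI₁ : ∀ᵐ x, 0 < density μ₁ x → x ∈ cdfInterval μ₁ :=
    ae_of_ae_density_pos h₁ (mem_cdfInterval_ae h₁)
  have hnz : ∀ {μ : Measure ℝ} [IsProbabilityMeasure μ], μ ≪ volume →
      volume ({x | 0 < density μ x} ∩ cdfInterval μ) ≠ 0 := by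
    intro μ _ hμ h0
    obtain ⟨x, hx, hx', hx''⟩ := ((measure_eq_zero_iff_ae_notMem.1 (hμ h0)).and
      ((density_pos_ae hμ).and (mem_cdfInterval_ae hμ))).exists
    exact hx ⟨hx', hx''⟩
  have hB := null_of_separated (I := cdfInterval μ₂) (Q := {y | 0 < density μ₂ y})
    (B := {y | y ∈ cdfInterval μ₂ ∧ density μ₂ y = 0})
    (Q' := {y | ∀ᵐ x, x ∈ {x | 0 < density μ₁ x} → x + y ∈ E})
    (B' := {y | ∀ᵐ x, x ∈ {x | 0 < density μ₁ x} → x + y ∉ E})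
    (isOpen_cdfInterval h₂) (ordConnected_cdfInterval μ₂).isPreconnected
    (fun y hy => (density_nonneg μ₂ y).eq_or_lt.elim (fun h => Or.inr ⟨hy, h.symm⟩) Or.inl)
    (hnz h₂)
    (by
      filter_upwards [hsw hE] with y hy hpos
      filter_upwards [hy] with x hx hx' using hx hx' hpos)
    (by
      filter_upwards [hsw hE'] with y hy hpos
      filter_upwards [hy, hI₁] with x hx hxI hx' using hx (hxI hx') hpos.1 hx' hpos.2)
    (exists_separation_of_translates (measurable_density μ₁ measurableSet_Ioi)
      (fun h0 => hnz h₁ (measure_mono_null inter_subset_left h0)) (fun _ h => h) (fun _ h => h))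
  filter_upwards [measure_eq_zero_iff_ae_notMem.1 hB] with y hy hyI
  refine (density_nonneg μ₂ y).lt_of_ne' fun h0 => hy ⟨⟨hyI, h0⟩, hyI⟩

/-- A law whose normal score has constant derivative is normal. -/
theorem eq_gaussianReal_of_scoreDeriv_const {μ : Measure ℝ} [IsProbabilityMeasure μ]
    (hμ : μ ≪ volume) {k : ℝ} (hk : 0 < k)
    (h : ∀ᵐ x, x ∈ cdfInterval μ → scoreDeriv μ x = k) :
    ∃ m : ℝ, μ = gaussianReal m (Real.toNNReal (k ^ 2)⁻¹) := by
  have hopen := isOpen_cdfInterval hμ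
  have hd : ∀ x ∈ cdfInterval μ, HasDerivAt (normalScore μ) k x := by
    intro x hx
    have hS : ContinuousAt (normalScore μ) x :=
      (continuousAt_gaussianQuantile hx).comp (continuous_cdf hμ).continuousAt
    have hF := hasDerivAt_cdf_of_density_eq hμ (hopen.mem_nhds hx)
      (g := fun y => gaussianPDFReal 0 1 (normalScore μ y) * k)
      (((continuous_gaussianPDFReal 0 1).continuousAt.comp hS).mul continuousAt_const)
      (by
        filter_upwards [h] with y hy hyI
        rw [density_eq_scoreDeriv, hy hyI])
    convert hasDerivAt_normalScore_of_cdf hx hF using 1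
    rw [mul_div_cancel_left₀ _ (gaussianPDFReal_pos 0 1 _ one_ne_zero).ne']
  obtain ⟨b, hb⟩ : ∃ b, ∀ x ∈ cdfInterval μ, normalScore μ x - k * x = b := by
    have hd' : ∀ x ∈ cdfInterval μ, HasDerivAt (fun y => normalScore μ y - k * y) 0 x := by
      intro x hx
      exact ((hd x hx).sub ((hasDerivAt_id x).const_mul k)).congr_deriv (by ring)
    exact hopen.exists_is_const_of_deriv_eq_zero (ordConnected_cdfInterval μ).isPreconnected
      (fun x hx => (hd' x hx).differentiableAt.differentiableWithinAt)
      (fun x hx => (hd' x hx).deriv)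
  have hmap : μ.map (fun x => k * x + b) = gaussianReal 0 1 := by
    rw [← map_normalScore hμ]
    refine Measure.map_congr ?_
    filter_upwards [mem_cdfInterval_ae hμ] with x hx
    rw [← hb x hx]; ring
  refine ⟨(0 - b) / k, ?_⟩
  have hback : μ = ((μ.map (fun x => k * x + b)).map (fun y => y - b)).map (fun y => y / k) := by
    rw [Measure.map_map (by fun_prop) (by fun_prop), Measure.map_map (by fun_prop) (by fun_prop)]
    convert Measure.map_id.symm using 2
    ext x
    simp only [Function.comp_apply, id_eq]
    field_simp
    ring
  rw [hback, hmap, gaussianReal_map_sub_const, gaussianReal_map_div_const]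
  congr 1
  ext
  simp [Real.coe_toNNReal _ (inv_nonneg.2 (sq_nonneg k))]

/-- The equality case of the Lieb splitting inequality: both laws are normal, with variances in
the ratio `c² : s²`. -/
theorem gaussian_of_lieb_splitting_eq {μ₁ μ₂ : Measure ℝ} [IsProbabilityMeasure μ₁]
    [IsProbabilityMeasure μ₂] (h₁ : μ₁ ≪ volume) (h₂ : μ₂ ≪ volume)
    (i₁ : Integrable (fun x => Real.log (density μ₁ x)) μ₁)
    (i₂ : Integrable (fun x => Real.log (density μ₂ x)) μ₂)
    (i : Integrable (fun x => Real.log (density (μ₁ ∗ μ₂) x)) (μ₁ ∗ μ₂))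
    {c s : ℝ} (hc : 0 < c) (hs : 0 < s) (hcs : c ^ 2 + s ^ 2 = 1)
    (heq : entropy (μ₁ ∗ μ₂) ≤
      c ^ 2 * (entropy μ₁ - Real.log c) + s ^ 2 * (entropy μ₂ - Real.log s)) :
    ∃ (v m₁ m₂ : ℝ), 0 < v ∧ μ₁ = gaussianReal m₁ (Real.toNNReal (c ^ 2 * v)) ∧
      μ₂ = gaussianReal m₂ (Real.toNNReal (s ^ 2 * v)) := by
  have hae := ae_of_lieb_splitting_eq h₁ h₂ i₁ i₂ i hc hs hcs heq
  have hK := transportKernel_ae_of_lieb_splitting_eq h₁ h₂ hc hs hcs (hae.mono fun p hp => hp.1)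
  have hpos := ae_of_ae_density_pos_prod h₁ h₂ (scoreDeriv_pos_ae h₁ h₂)
  have hE : ∀ᵐ p : ℝ × ℝ, 0 < density μ₁ p.1 → 0 < density μ₂ p.2 →
      p.1 + p.2 ∈ {x | 0 < density (μ₁ ∗ μ₂) x} := by
    filter_upwards [hpos] with p hp a b using (hp a b).2.2
  -- where exactly one density vanishes, the kernel vanishes only through the density of the sum
  have hE' : ∀ᵐ p : ℝ × ℝ, p.1 ∈ cdfInterval μ₁ → p.2 ∈ cdfInterval μ₂ →
      (0 < density μ₁ p.1 ∧ density μ₂ p.2 = 0 ∨ density μ₁ p.1 = 0 ∧ 0 < density μ₂ p.2) →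
      p.1 + p.2 ∉ {x | 0 < density (μ₁ ∗ μ₂) x} := by
    filter_upwards [hK] with p hp a b h hmem
    have h0 := hp a b (by tauto)
    have hφ := gaussianPDFReal_pos 0 1 (c * normalScore μ₂ p.2 - s * normalScore μ₁ p.1) one_ne_zero
    have hsum : 0 < s * scoreDeriv μ₁ p.1 + c * scoreDeriv μ₂ p.2 := by
      have n1 := scoreDeriv_nonneg μ₁ p.1
      have n2 := scoreDeriv_nonneg μ₂ p.2
      rcases h with h | h
      · have := (scoreDeriv_pos_iff _ _).2 h.1
        positivity
      · have := (scoreDeriv_pos_iff _ _).2 h.2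
        positivity
    exact (mul_pos hmem (mul_pos hφ hsum)).ne' h0
  have hp₂ := density_pos_ae_cdfInterval h₁ h₂ hE (by
    filter_upwards [hE'] with p hp a b a' b' using hp a b (Or.inl ⟨a', b'⟩))
  have hsw : ∀ {r : ℝ × ℝ → Prop}, (∀ᵐ p : ℝ × ℝ, r p) → ∀ᵐ p : ℝ × ℝ, r p.swap := by
    intro r hr
    rw [Measure.volume_eq_prod] at hr ⊢
    exact Measure.measurePreserving_swap.quasiMeasurePreserving.ae hr
  have hp₁ := density_pos_ae_cdfInterval h₂ h₁ (E := {x | 0 < density (μ₁ ∗ μ₂) x})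
    (by
      filter_upwards [hsw hE] with p hp a b
      rw [add_comm]
      exact hp b a)
    (by
      filter_upwards [hsw hE'] with p hp a b a' b'
      rw [add_comm]
      exact hp b a (Or.inr ⟨b', a'⟩))
  obtain ⟨k, hk, hk₁, hk₂⟩ : ∃ k > 0, (∀ᵐ x ∂μ₁, c * scoreDeriv μ₁ x = k) ∧
      ∀ᵐ y ∂μ₂, s * scoreDeriv μ₂ y = k := by
    have hfib := Measure.ae_ae_of_ae_prod hae
    obtain ⟨x₀, hx₀, hx₀p⟩ := (hfib.and (density_pos_ae h₁)).exists
    refine ⟨c * scoreDeriv μ₁ x₀, mul_pos hc ((scoreDeriv_pos_iff _ _).2 hx₀p), ?_, ?_⟩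
    · filter_upwards [hfib] with x hx
      obtain ⟨y, hy, hy'⟩ := (hx.and hx₀).exists
      exact hy.2.trans hy'.2.symm
    · filter_upwards [hx₀] with y hy using hy.2.symm
  have hc₁ : ∀ᵐ x, x ∈ cdfInterval μ₁ → scoreDeriv μ₁ x = k / c := by
    filter_upwards [hp₁, ae_of_ae_density_pos h₁ hk₁] with x hx hx' hI
    rw [eq_div_iff hc.ne', mul_comm]
    exact hx' (hx hI)
  have hc₂ : ∀ᵐ x, x ∈ cdfInterval μ₂ → scoreDeriv μ₂ x = k / s := by
    filter_upwards [hp₂, ae_of_ae_density_pos h₂ hk₂] with x hx hx' hI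
    rw [eq_div_iff hs.ne', mul_comm]
    exact hx' (hx hI)
  obtain ⟨m₁, hm₁⟩ := eq_gaussianReal_of_scoreDeriv_const h₁ (div_pos hk hc) hc₁
  obtain ⟨m₂, hm₂⟩ := eq_gaussianReal_of_scoreDeriv_const h₂ (div_pos hk hs) hc₂
  refine ⟨(k ^ 2)⁻¹, m₁, m₂, by positivity, ?_, ?_⟩
  · convert hm₁ using 3; field_simp
  · convert hm₂ using 3; field_simp

/-! ### The mean square error of a normal law -/

/-- For a normal law of variance `v` the residual after linear regression is independent of the
observation, so the conditional expectation is linear. -/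
theorem mmse_gaussianReal (m : ℝ) (v : NNReal) {γ : ℝ} (hγ : 0 ≤ γ) :
    mmse (gaussianReal m v) γ = v / (1 + γ * v) := by
  set ν : Measure (ℝ × ℝ) := (gaussianReal m v).prod (gaussianReal 0 1) with hν
  set r : ℝ := √γ with hr
  have hr2 : r ^ 2 = γ := Real.sq_sqrt hγ
  set Y : ℝ × ℝ → ℝ := fun p => p.1 * r + p.2 with hY
  have hYm : Measurable Y := by fun_prop
  have hden : 0 < 1 + γ * v := by positivity
  -- the regression coefficient of the signal on the observation
  set k : ℝ := r * v / (1 + γ * v) with hk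
  set R : ℝ × ℝ → ℝ := fun p => p.1 - k * Y p with hR
  have hRm : Measurable R := by fun_prop
  have hX2 : MemLp (fun p : ℝ × ℝ => p.1) 2 ν := (memLp_id_gaussianReal 2).comp_fst _
  have hN2 : MemLp (fun p : ℝ × ℝ => p.2) 2 ν := (memLp_id_gaussianReal 2).comp_snd _
  have hY2 : MemLp Y 2 ν := (hX2.mul_const r).add hN2
  have hR2 : MemLp R 2 ν := hX2.sub (hY2.const_mul k)
  have hcXN : cov[fun p : ℝ × ℝ => p.1, fun p => p.2; ν] = 0 :=
    covariance_fst_snd_prod (X := fun x : ℝ => x) (Y := fun x : ℝ => x) (memLp_id_gaussianReal 2)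
      (memLp_id_gaussianReal 2)
  have hvX : Var[fun p : ℝ × ℝ => p.1; ν] = v := by
    have := (measurePreserving_fst (μ := gaussianReal m v)
      (ν := gaussianReal 0 1)).variance_fun_comp (f := fun x : ℝ => x) measurable_id.aemeasurable
    rwa [variance_fun_id_gaussianReal] at this
  have hvN : Var[fun p : ℝ × ℝ => p.2; ν] = 1 := by
    have := (measurePreserving_snd (μ := gaussianReal m v)
      (ν := gaussianReal 0 1)).variance_fun_comp (f := fun x : ℝ => x) measurable_id.aemeasurable
    rwa [variance_fun_id_gaussianReal] at this
  have hcXY : cov[fun p : ℝ × ℝ => p.1, Y; ν] = r * v := by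
    have : Y = (fun p : ℝ × ℝ => p.1 * r) + fun p => p.2 := rfl
    rw [this, covariance_add_right hX2 (hX2.mul_const r) hN2, hcXN, covariance_mul_const_right,
      covariance_self hX2.aemeasurable, hvX]
    ring
  have hvY : Var[Y; ν] = 1 + γ * v := by
    have : Y = (fun p : ℝ × ℝ => p.1 * r) + fun p => p.2 := rfl
    rw [this, variance_add (hX2.mul_const r) hN2, covariance_mul_const_left, hcXN, hvN,
      variance_mul_const, hvX, hr2]
    ring
  have hcRY : cov[R, Y; ν] = 0 := by
    have : R = (fun p : ℝ × ℝ => p.1) - fun p => k * Y p := rfl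
    rw [this, covariance_sub_left hX2 (hY2.const_mul k) hY2, covariance_const_mul_left,
      covariance_self hY2.aemeasurable, hcXY, hvY, hk, div_mul_cancel₀ _ hden.ne', sub_self]
  have hvR : Var[R; ν] = v / (1 + γ * v) := by
    have : R = (fun p : ℝ × ℝ => p.1) - fun p => k * Y p := rfl
    rw [this, variance_sub hX2 (hY2.const_mul k), covariance_const_mul_right, hcXY, hvX,
      variance_const_mul, hvY, hk]
    field_simp
    rw [hr2]
    ring
  have hlaw : HasGaussianLaw (fun p : ℝ × ℝ => (R p, Y p)) ν := by
    have h1 : HasGaussianLaw (fun p : ℝ × ℝ => (p.1, p.2)) ν := by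
      have hX : HasGaussianLaw (fun p : ℝ × ℝ => p.1) ν :=
        ⟨by rw [hν, Measure.map_fst_prod]; simp; infer_instance⟩
      have hN : HasGaussianLaw (fun p : ℝ × ℝ => p.2) ν :=
        ⟨by rw [hν, Measure.map_snd_prod]; simp; infer_instance⟩
      exact IndepFun.hasGaussianLaw hX hN
        (indepFun_prod (X := fun x : ℝ => x) (Y := fun x : ℝ => x) measurable_id measurable_id)
    let Yl : ℝ × ℝ →L[ℝ] ℝ := r • ContinuousLinearMap.fst ℝ ℝ ℝ + ContinuousLinearMap.snd ℝ ℝ ℝ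
    have h2 := h1.map_fun ((ContinuousLinearMap.fst ℝ ℝ ℝ - k • Yl).prod Yl)
    refine h2.congr (ae_of_all _ fun p => ?_)
    simp only [Yl, hR, hY, ContinuousLinearMap.prod_apply, _root_.sub_apply,
      _root_.add_apply, _root_.smul_apply, smul_eq_mul,
      ContinuousLinearMap.coe_fst', ContinuousLinearMap.coe_snd', mul_comm]
  have hind : IndepFun R Y ν := hlaw.indepFun_of_covariance_eq_zero hcRY
  have hle : MeasurableSpace.comap Y inferInstance ≤ (inferInstance : MeasurableSpace (ℝ × ℝ)) :=
    hYm.comap_le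
  have hce : ν[fun p : ℝ × ℝ => p.1 | MeasurableSpace.comap Y inferInstance] =ᵐ[ν]
      fun p => k * Y p + ∫ q, R q ∂ν := by
    have e : (fun p : ℝ × ℝ => p.1) = (fun p => k * Y p) + R := by
      ext p
      simp [hR]
    have hkY : Integrable (fun p => k * Y p) ν := (hY2.const_mul k).integrable one_le_two
    have e1 : ν[fun p => k * Y p | MeasurableSpace.comap Y inferInstance] = fun p => k * Y p :=
      condExp_of_stronglyMeasurable hle
        ((comap_measurable Y).const_mul k).stronglyMeasurable hkY
    have e2 : ν[R | MeasurableSpace.comap Y inferInstance] =ᵐ[ν] fun _ => ∫ q, R q ∂ν :=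
      condExp_indep_eq hRm.comap_le hle (comap_measurable R).stronglyMeasurable hind
    rw [e]
    refine (condExp_add hkY (hR2.integrable one_le_two) _).trans ?_
    rw [e1]
    filter_upwards [e2] with p hp
    rw [Pi.add_apply, hp]
  have hgoal : mmse (gaussianReal m v) γ = ∫ p : ℝ × ℝ,
      (p.1 - (ν[fun q : ℝ × ℝ => q.1 | MeasurableSpace.comap Y inferInstance]) p) ^ 2 ∂ν := rfl
  rw [hgoal, ← hvR, variance_eq_integral hRm.aemeasurable]
  refine integral_congr_ae ?_
  filter_upwards [hce] with p hp
  rw [hp]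
  simp only [hR]
  ring

/-! ### Weighted entropies of laws -/

/-- The weighted differential entropy of a law on the line. -/
noncomputable def lawEntropy (φ : ℝ → ℝ) (μ : Measure ℝ) : ℝ :=
  -∫ x, φ x * Real.log (density μ x) ∂μ

theorem weightedEntropy_eq_lawEntropy {Ω : Type*} [MeasurableSpace Ω] (P : Measure Ω) {Z : Ω → ℝ}
    (hZ : Measurable Z) {φ : ℝ → ℝ} (hφ : Measurable φ) :
    weightedEntropy φ P Z = lawEntropy φ (P.map Z) := by
  rw [weightedEntropy, lawEntropy, integral_map hZ.aemeasurable]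
  exact (hφ.mul (measurable_density _).log).aestronglyMeasurable

/-- The mean absolute value of the logarithm of the density. -/
noncomputable def absEntropy (μ : Measure ℝ) : ℝ := ∫ x, |Real.log (density μ x)| ∂μ

theorem absEntropy_nonneg (μ : Measure ℝ) : 0 ≤ absEntropy μ :=
  integral_nonneg fun _ => abs_nonneg _

theorem abs_entropy_le (μ : Measure ℝ) : |entropy μ| ≤ absEntropy μ := by
  rw [entropy, abs_neg]
  exact abs_integral_le_integral_abs

theorem integrable_mul_log_density {μ : Measure ℝ} {φ : ℝ → ℝ} {a ε : ℝ}
    (hφ : Measurable φ) (h : ∀ x, |φ x - a| < ε)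
    (i : Integrable (fun x => Real.log (density μ x)) μ) :
    Integrable (fun x => φ x * Real.log (density μ x)) μ := by
  refine i.bdd_mul (c := ε + |a|) hφ.aestronglyMeasurable (ae_of_all _ fun x => ?_)
  have := abs_sub_abs_le_abs_sub (φ x) a
  rw [Real.norm_eq_abs]
  linarith [h x]

theorem abs_lawEntropy_sub_le {μ : Measure ℝ} {φ : ℝ → ℝ} {a ε : ℝ}
    (hφ : Measurable φ) (h : ∀ x, |φ x - a| < ε)
    (i : Integrable (fun x => Real.log (density μ x)) μ) :
    |lawEntropy φ μ - a * entropy μ| ≤ ε * absEntropy μ := by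
  have e : lawEntropy φ μ - a * entropy μ = -∫ x, (φ x - a) * Real.log (density μ x) ∂μ := by
    have := integral_sub (integrable_mul_log_density hφ h i) (i.const_mul a)
    simp only [sub_mul]
    rw [this, integral_const_mul, lawEntropy, entropy]
    ring
  rw [e, abs_neg, absEntropy, ← integral_const_mul]
  refine norm_integral_le_of_norm_le (f := fun x => (φ x - a) * Real.log (density μ x))
    (i.abs.const_mul ε) (ae_of_all _ fun x => ?_)
  rw [Real.norm_eq_abs, abs_mul]
  exact mul_le_mul_of_nonneg_right (h x).le (abs_nonneg _)

section Perturbation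

variable {μ : Measure ℝ} [IsProbabilityMeasure μ] {φ : ℝ → ℝ} {a ε : ℝ}

theorem integrable_of_abs_sub_lt (hφ : Measurable φ) (h : ∀ x, |φ x - a| < ε) :
    Integrable φ μ := by
  have : Integrable (fun x => φ x - a) μ :=
    Integrable.of_bound (hφ.sub_const a).aestronglyMeasurable ε (ae_of_all _ fun x => (h x).le)
  refine (this.add (integrable_const a)).congr (ae_of_all _ fun x => ?_)
  simp

theorem abs_integral_sub_le (hφ : Measurable φ) (h : ∀ x, |φ x - a| < ε) :
    |∫ x, φ x ∂μ - a| ≤ ε := by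
  have e : ∫ x, φ x ∂μ - a = ∫ x, (φ x - a) ∂μ := by
    rw [integral_sub (integrable_of_abs_sub_lt hφ h) (integrable_const a)]
    simp
  rw [e]
  simpa using norm_integral_le_of_norm_le_const (μ := μ) (f := fun x => φ x - a)
    (ae_of_all _ fun x => (h x).le)

/-- Normalized weighted entropies are close to the entropy when the weight is close to a
constant. -/
theorem abs_lawEntropy_div_sub_le (hφ : Measurable φ) (h : ∀ x, |φ x - a| < ε) (ha : 0 < a)
    (hε : ε ≤ a / 2) (i : Integrable (fun x => Real.log (density μ x)) μ) :
    |lawEntropy φ μ / (∫ x, φ x ∂μ) - entropy μ| ≤ 4 * absEntropy μ * (ε / a) := by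
  have h1 := abs_lawEntropy_sub_le hφ h i
  have h2 := abs_integral_sub_le (μ := μ) hφ h
  have hε0 : 0 ≤ ε := (abs_nonneg _).trans (h 0).le
  set I := ∫ x, φ x ∂μ
  have hI : a / 2 ≤ I := by linarith [(abs_le.1 h2).1]
  have hI0 : 0 < I := by linarith
  have e : lawEntropy φ μ / I - entropy μ =
      ((lawEntropy φ μ - a * entropy μ) - entropy μ * (I - a)) / I := by
    field_simp
    ring
  have h3 : |entropy μ * (I - a)| ≤ absEntropy μ * ε := by
    rw [abs_mul]
    exact mul_le_mul (abs_entropy_le μ) h2 (abs_nonneg _) (absEntropy_nonneg μ)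
  have h4 := abs_sub (lawEntropy φ μ - a * entropy μ) (entropy μ * (I - a))
  rw [e, abs_div, abs_of_pos hI0, div_le_iff₀ hI0]
  have h5 : 4 * absEntropy μ * (ε / a) * (a / 2) ≤ 4 * absEntropy μ * (ε / a) * I := by
    have := absEntropy_nonneg μ
    gcongr
  have h6 : 4 * absEntropy μ * (ε / a) * (a / 2) = 2 * (ε * absEntropy μ) := by
    field_simp
    ring
  linarith

end Perturbation

/-! ### Rescaling -/

/-- The density of `X / c` at `x / c` is `c` times the density of `X` at `x`. -/
theorem density_map_div {μ : Measure ℝ} [IsProbabilityMeasure μ] {c : ℝ} (hc : 0 < c) :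
    ∀ᵐ x, density (μ.map (fun x => x / c)) (x / c) = c * density μ x := by
  have hemb : MeasurableEmbedding (fun x : ℝ => x / c) :=
    (Homeomorph.mulRight₀ c⁻¹ (inv_ne_zero hc.ne')).measurableEmbedding
  have hvol : (volume : Measure ℝ).map (fun x : ℝ => x / c) = ENNReal.ofReal c • volume := by
    have := Real.map_volume_mul_right (inv_ne_zero hc.ne')
    rw [inv_inv, abs_of_pos hc] at this
    exact this
  have hprob : IsProbabilityMeasure (μ.map (fun x : ℝ => x / c)) :=
    Measure.isProbabilityMeasure_map (by fun_prop)
  have h1 := hemb.rnDeriv_map μ volume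
  rw [hvol] at h1
  have h2 := Measure.rnDeriv_smul_right_of_ne_top (μ.map (fun x : ℝ => x / c)) volume
    (r := ENNReal.ofReal c) (by simpa using hc) ENNReal.ofReal_ne_top
  have h3 : ∀ᵐ x : ℝ, (μ.map (fun x : ℝ => x / c)).rnDeriv (ENNReal.ofReal c • volume) (x / c) =
      ((ENNReal.ofReal c)⁻¹ • (μ.map (fun x : ℝ => x / c)).rnDeriv volume) (x / c) := by
    have hq : Measure.QuasiMeasurePreserving (fun x : ℝ => x / c) volume volume :=
      ⟨by fun_prop, by rw [hvol]; exact Measure.smul_absolutelyContinuous⟩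
    exact hq.ae h2
  filter_upwards [h1, h3] with x hx hx'
  rw [density, density, ← hx, hx', Pi.smul_apply, smul_eq_mul, ENNReal.toReal_mul,
    ENNReal.toReal_inv, ENNReal.toReal_ofReal hc.le, mul_inv_cancel_left₀ hc.ne']

theorem log_density_map_div {μ : Measure ℝ} [IsProbabilityMeasure μ] (hμ : μ ≪ volume) {c : ℝ}
    (hc : 0 < c) :
    ∀ᵐ x ∂μ, Real.log (density (μ.map (fun x => x / c)) (x / c)) =
      Real.log c + Real.log (density μ x) := by
  filter_upwards [hμ.ae_le (density_map_div (μ := μ) hc), density_pos_ae hμ] with x hx hpos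
  rw [hx, Real.log_mul hc.ne' hpos.ne']

theorem integrable_log_density_of_map_div {μ : Measure ℝ} [IsProbabilityMeasure μ]
    (hμ : μ ≪ volume) {c : ℝ} (hc : 0 < c)
    (i : Integrable (fun x => Real.log (density (μ.map (fun x => x / c)) x))
      (μ.map (fun x => x / c))) :
    Integrable (fun x => Real.log (density μ x)) μ := by
  have h := i.comp_measurable (f := fun x : ℝ => x / c) (by fun_prop)
  refine (h.sub (integrable_const (Real.log c))).congr ?_
  filter_upwards [log_density_map_div hμ hc] with x hx
  simp only [Pi.sub_apply, Function.comp_apply, hx, add_sub_cancel_left]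

theorem lawEntropy_map_div {μ : Measure ℝ} [IsProbabilityMeasure μ] (hμ : μ ≪ volume) {c : ℝ}
    (hc : 0 < c) {φ : ℝ → ℝ} {a ε : ℝ} (hφ : Measurable φ) (h : ∀ x, |φ x - a| < ε)
    (i : Integrable (fun x => Real.log (density μ x)) μ) :
    lawEntropy (fun x => φ (x * c)) (μ.map (fun x => x / c)) =
      lawEntropy φ μ - Real.log c * ∫ x, φ x ∂μ := by
  have hm : Measurable fun x => φ (x * c) *
      Real.log (density (μ.map (fun x => x / c)) x) :=
    (hφ.comp (measurable_mul_const c)).mul (measurable_density _).log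
  rw [lawEntropy, integral_map (by fun_prop) hm.aestronglyMeasurable]
  have e : ∫ x, φ (x / c * c) * Real.log (density (μ.map (fun x => x / c)) (x / c)) ∂μ =
      ∫ x, (φ x * Real.log (density μ x) + Real.log c * φ x) ∂μ := by
    refine integral_congr_ae ?_
    filter_upwards [log_density_map_div hμ hc] with x hx
    rw [hx, div_mul_cancel₀ _ hc.ne']
    ring
  rw [e, integral_add (integrable_mul_log_density hφ h i)
    ((integrable_of_abs_sub_lt hφ h).const_mul _), integral_const_mul, lawEntropy]
  ring

/-- The mean square error of a rescaled normal law, multiplied by the square of the scale. -/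
theorem mmse_gaussianReal_map_div (m : ℝ) {v c γ : ℝ} (hv : 0 ≤ v) (hc : 0 < c) (hγ : 0 ≤ γ) :
    mmse ((gaussianReal m v.toNNReal).map (fun x => x / c)) γ * c ^ 2 =
      v / (1 + γ * (v / c ^ 2)) := by
  rw [gaussianReal_map_div_const, mmse_gaussianReal _ _ hγ]
  rw [NNReal.coe_div, Real.coe_toNNReal _ hv, NNReal.coe_mk]
  field_simp

/-! ### Splitting angles -/

/-- The splitting bound `c² (h₁ - log c) + s² (h₂ - log s)` is largest when
`h₁ - log c = h₂ - log s`, where it is one half of the logarithm of the sum of the entropy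
powers. -/
theorem splitting_le_of_balanced {h₁ h₂ c₀ s₀ c s : ℝ} (hc₀ : 0 < c₀) (hs₀ : 0 < s₀) (hc : 0 < c)
    (hs : 0 < s) (hcs₀ : c₀ ^ 2 + s₀ ^ 2 = 1) (hcs : c ^ 2 + s ^ 2 = 1)
    (hbal : h₁ - Real.log c₀ = h₂ - Real.log s₀) :
    c ^ 2 * (h₁ - Real.log c) + s ^ 2 * (h₂ - Real.log s) ≤
      c₀ ^ 2 * (h₁ - Real.log c₀) + s₀ ^ 2 * (h₂ - Real.log s₀) := by
  have key : ∀ {x y : ℝ}, 0 < x → 0 < y →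
      y ^ 2 * (2 * (Real.log x - Real.log y)) ≤ x ^ 2 - y ^ 2 := by
    intro x y hx hy
    have h := Real.log_le_sub_one_of_pos (x := x ^ 2 / y ^ 2) (by positivity)
    rw [Real.log_div (by positivity) (by positivity), Real.log_pow, Real.log_pow] at h
    have h' := mul_le_mul_of_nonneg_left h (sq_nonneg y)
    have e : y ^ 2 * (x ^ 2 / y ^ 2 - 1) = x ^ 2 - y ^ 2 := by field_simp
    rw [e] at h'
    push_cast at h'
    linarith
  have k1 := key hc₀ hc
  have k2 := key hs₀ hs
  have e1 : c₀ ^ 2 * (h₁ - Real.log c₀) + s₀ ^ 2 * (h₂ - Real.log s₀) = h₁ - Real.log c₀ := by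
    rw [← hbal, ← add_mul, hcs₀, one_mul]
  have e2 : h₁ - Real.log c₀ = c ^ 2 * (h₁ - Real.log c₀) + s ^ 2 * (h₂ - Real.log s₀) := by
    rw [← hbal, ← add_mul, hcs, one_mul]
  rw [e1, e2]
  linarith

theorem cos_arctan_exp_pos (t : ℝ) : 0 < Real.cos (Real.arctan (Real.exp t)) :=
  Real.cos_arctan_pos _

theorem sin_arctan_exp_pos (t : ℝ) : 0 < Real.sin (Real.arctan (Real.exp t)) := by
  rw [Real.sin_arctan]
  positivity

theorem log_sin_arctan_exp (t : ℝ) : Real.log (Real.sin (Real.arctan (Real.exp t))) =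
    t + Real.log (Real.cos (Real.arctan (Real.exp t))) := by
  have h : Real.sin (Real.arctan (Real.exp t)) =
      Real.exp t * Real.cos (Real.arctan (Real.exp t)) := by
    rw [Real.sin_arctan, Real.cos_arctan]
    ring
  rw [h, Real.log_mul (Real.exp_pos t).ne' (cos_arctan_exp_pos t).ne', Real.log_exp]

theorem neg_sq_mul_log_le_one {c : ℝ} (hc : 0 < c) : -(c ^ 2 * Real.log c) ≤ 1 := by
  have h := Real.log_le_sub_one_of_pos (inv_pos.2 hc)
  rw [Real.log_inv] at h
  have h' := mul_le_mul_of_nonneg_left h (sq_nonneg c)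
  have e : c ^ 2 * (c⁻¹ - 1) = c - c ^ 2 := by field_simp
  rw [e] at h'
  nlinarith [sq_nonneg (c - 1)]

/-- A gap in the unweighted Lieb splitting inequality survives a small perturbation of the
weight. -/
theorem weighted_splitting_of_gap {μ₁ μ₂ : Measure ℝ} [IsProbabilityMeasure μ₁]
    [IsProbabilityMeasure μ₂]
    (i₁ : Integrable (fun x => Real.log (density μ₁ x)) μ₁)
    (i₂ : Integrable (fun x => Real.log (density μ₂ x)) μ₂)
    (i : Integrable (fun x => Real.log (density (μ₁ ∗ μ₂) x)) (μ₁ ∗ μ₂))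
    {φ : ℝ → ℝ} {a ε M c s : ℝ} (hφ : Measurable φ) (h : ∀ x, |φ x - a| < ε) (ha : 0 < a)
    (hc : 0 < c) (hs : 0 < s) (hcs : c ^ 2 + s ^ 2 = 1)
    (hM : c ^ 2 * (entropy μ₁ - Real.log c) + s ^ 2 * (entropy μ₂ - Real.log s) ≤ M)
    (hε : ε * (absEntropy μ₁ + absEntropy μ₂ + absEntropy (μ₁ ∗ μ₂) + 2) ≤
      a * (entropy (μ₁ ∗ μ₂) - M)) :
    c ^ 2 * (lawEntropy φ μ₁ - Real.log c * ∫ x, φ x ∂μ₁) +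
      s ^ 2 * (lawEntropy φ μ₂ - Real.log s * ∫ x, φ x ∂μ₂) ≤ lawEntropy φ (μ₁ ∗ μ₂) := by
  have hε0 : 0 ≤ ε := (abs_nonneg _).trans (h 0).le
  have bound : ∀ {μ : Measure ℝ} [IsProbabilityMeasure μ] {b : ℝ}, 0 < b → b ^ 2 ≤ 1 →
      Integrable (fun x => Real.log (density μ x)) μ →
      b ^ 2 * (lawEntropy φ μ - Real.log b * ∫ x, φ x ∂μ) ≤
        a * (b ^ 2 * (entropy μ - Real.log b)) + ε * (absEntropy μ + 1) := by
    intro μ _ b hb hb1 j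
    have e1 := (abs_le.1 (abs_lawEntropy_sub_le hφ h j)).2
    have e2 := (abs_le.1 (abs_integral_sub_le (μ := μ) hφ h)).2
    have hlog : 0 ≤ -Real.log b := by
      have := Real.log_nonpos hb.le (by nlinarith : b ≤ 1)
      linarith
    have e3 : b ^ 2 * (lawEntropy φ μ - a * entropy μ) ≤ 1 * (ε * absEntropy μ) := by
      refine (mul_le_mul_of_nonneg_left e1 (sq_nonneg b)).trans ?_
      exact mul_le_mul_of_nonneg_right hb1 (mul_nonneg hε0 (absEntropy_nonneg μ))
    have e4 : b ^ 2 * -Real.log b * (∫ x, φ x ∂μ - a) ≤ b ^ 2 * -Real.log b * ε :=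
      mul_le_mul_of_nonneg_left e2 (mul_nonneg (sq_nonneg b) hlog)
    have e5 : -(b ^ 2 * Real.log b) * ε ≤ 1 * ε :=
      mul_le_mul_of_nonneg_right (neg_sq_mul_log_le_one hb) hε0
    linarith
  have b₁ := bound hc (by nlinarith [sq_nonneg s]) i₁
  have b₂ := bound hs (by nlinarith [sq_nonneg c]) i₂
  have b := (abs_le.1 (abs_lawEntropy_sub_le hφ h i)).1
  have hM' := mul_le_mul_of_nonneg_left hM ha.le
  linarith

/-! ### Passage to random variables -/

section RandomVariables

variable {Ω : Type*} [MeasurableSpace Ω] {P : Measure Ω} {X₁ X₂ : Ω → ℝ}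

theorem map_div_eq (h : Measurable X₁) (c : ℝ) :
    P.map (fun ω => X₁ ω / c) = (P.map X₁).map (fun x => x / c) := by
  rw [Measure.map_map (by fun_prop) h]
  rfl

theorem angle_eq (h₁ : Measurable X₁) (h₂ : Measurable X₂) {φ : ℝ → ℝ} (hφ : Measurable φ) :
    angle φ P X₁ X₂ = Real.arctan (Real.exp
      (lawEntropy φ (P.map X₂) / (∫ x, φ x ∂(P.map X₂)) -
        lawEntropy φ (P.map X₁) / (∫ x, φ x ∂(P.map X₁)))) := by
  rw [angle, weightedEntropy_eq_lawEntropy P h₁ hφ, weightedEntropy_eq_lawEntropy P h₂ hφ,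
    integral_map h₁.aemeasurable hφ.aestronglyMeasurable,
    integral_map h₂.aemeasurable hφ.aestronglyMeasurable]

theorem angle_const [IsProbabilityMeasure P] (h₁ : Measurable X₁) (h₂ : Measurable X₂) {a : ℝ}
    (ha : a ≠ 0) :
    angle (fun _ => a) P X₁ X₂ =
      Real.arctan (Real.exp (entropy (P.map X₂) - entropy (P.map X₁))) := by
  have e : ∀ {X : Ω → ℝ}, Measurable X →
      lawEntropy (fun _ => a) (P.map X) / (∫ _, a ∂(P.map X)) = entropy (P.map X) := by
    intro X hX
    have := Measure.isProbabilityMeasure_map (μ := P) hX.aemeasurable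
    rw [lawEntropy, integral_const_mul, integral_const, entropy]
    simp only [probReal_univ, smul_eq_mul, one_mul]
    field_simp
  rw [angle_eq h₁ h₂ measurable_const, e h₁, e h₂]

theorem FiniteEntropyAndVariance.integrable_log_density {Z : Ω → ℝ} (hZ : Measurable Z)
    (h : FiniteEntropyAndVariance P Z) :
    Integrable (fun x => Real.log (density (P.map Z) x)) (P.map Z) := by
  rw [integrable_map_measure (measurable_density _).log.aestronglyMeasurable hZ.aemeasurable]
  exact h.1

theorem MMSEGap.integrable_log_density [IsProbabilityMeasure P] (h₁ : Measurable X₁)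
    (h₂ : Measurable X₂) (hi : IndepFun X₁ X₂ P) (ac₁ : P.map X₁ ≪ volume)
    (ac₂ : P.map X₂ ≪ volume) {γ₀ δ α : ℝ} (hc : 0 < Real.cos α) (hs : 0 < Real.sin α)
    (h : MMSEGap P X₁ X₂ γ₀ δ α) :
    Integrable (fun x => Real.log (density (P.map X₁) x)) (P.map X₁) ∧
      Integrable (fun x => Real.log (density (P.map X₂) x)) (P.map X₂) ∧
      Integrable (fun x => Real.log (density (P.map X₁ ∗ P.map X₂) x)) (P.map X₁ ∗ P.map X₂) := by
  have := Measure.isProbabilityMeasure_map (μ := P) h₁.aemeasurable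
  have := Measure.isProbabilityMeasure_map (μ := P) h₂.aemeasurable
  obtain ⟨r₁, r₂, r, -⟩ := h
  have j₁ := r₁.1.integrable_log_density (h₁.div_const _)
  have j₂ := r₂.1.integrable_log_density (h₂.div_const _)
  have j := r.1.integrable_log_density (h₁.fun_add h₂)
  rw [map_div_eq h₁] at j₁
  rw [map_div_eq h₂] at j₂
  have hconv : P.map (fun ω => X₁ ω + X₂ ω) = P.map X₁ ∗ P.map X₂ :=
    hi.map_add_eq_map_conv_map₀ h₁.aemeasurable h₂.aemeasurable
  rw [hconv] at j
  exact ⟨integrable_log_density_of_map_div ac₁ hc j₁, integrable_log_density_of_map_div ac₂ hs j₂,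
    j⟩

/-- The weighted inequality holds when `M` bounds the unweighted splitting at every angle and the
weight is close to a constant compared with the gap between `M` and the entropy of the sum. -/
theorem WLSI_of_gap [IsProbabilityMeasure P] (h₁ : Measurable X₁)
    (h₂ : Measurable X₂) (hi : IndepFun X₁ X₂ P) (ac₁ : P.map X₁ ≪ volume)
    (ac₂ : P.map X₂ ≪ volume)
    (i₁ : Integrable (fun x => Real.log (density (P.map X₁) x)) (P.map X₁))
    (i₂ : Integrable (fun x => Real.log (density (P.map X₂) x)) (P.map X₂))
    (i : Integrable (fun x => Real.log (density (P.map X₁ ∗ P.map X₂) x)) (P.map X₁ ∗ P.map X₂))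
    {φ : ℝ → ℝ} {a ε M : ℝ} (hφ : Measurable φ) (h : ∀ x, |φ x - a| < ε) (ha : 0 < a)
    (hM : ∀ c s : ℝ, 0 < c → 0 < s → c ^ 2 + s ^ 2 = 1 →
      c ^ 2 * (entropy (P.map X₁) - Real.log c) + s ^ 2 * (entropy (P.map X₂) - Real.log s) ≤ M)
    (hε : ε * (absEntropy (P.map X₁) + absEntropy (P.map X₂) +
        absEntropy (P.map X₁ ∗ P.map X₂) + 2) ≤ a * (entropy (P.map X₁ ∗ P.map X₂) - M)) :
    WLSI φ P X₁ X₂ := by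
  have := Measure.isProbabilityMeasure_map (μ := P) h₁.aemeasurable
  have := Measure.isProbabilityMeasure_map (μ := P) h₂.aemeasurable
  have hconv : P.map (fun ω => X₁ ω + X₂ ω) = P.map X₁ ∗ P.map X₂ :=
    hi.map_add_eq_map_conv_map₀ h₁.aemeasurable h₂.aemeasurable
  rw [WLSI]
  have hc : 0 < Real.cos (angle φ P X₁ X₂) := cos_arctan_exp_pos _
  have hs : 0 < Real.sin (angle φ P X₁ X₂) := sin_arctan_exp_pos _
  have hcs := Real.cos_sq_add_sin_sq (angle φ P X₁ X₂)
  set α := angle φ P X₁ X₂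
  change Real.cos α ^ 2 * _ + Real.sin α ^ 2 * _ ≤ _
  have hφm : ∀ b : ℝ, Measurable fun x => φ (x * b) := fun b => hφ.comp (measurable_mul_const b)
  rw [weightedEntropy_eq_lawEntropy P (h₁.div_const _) (hφm _),
    weightedEntropy_eq_lawEntropy P (h₂.div_const _) (hφm _),
    weightedEntropy_eq_lawEntropy P (h₁.fun_add h₂) hφ, hconv, map_div_eq h₁, map_div_eq h₂,
    lawEntropy_map_div ac₁ hc hφ h i₁, lawEntropy_map_div ac₂ hs hφ h i₂]
  exact weighted_splitting_of_gap i₁ i₂ i hφ h ha hc hs hcs (hM _ _ hc hs hcs) hε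

end RandomVariables

/-- For normal laws of variances `c₀² v` and `s₀² v`, the difference of mean square errors at the
angle `arctan (exp t)`. -/
noncomputable def gaussianGap (v γ c₀ s₀ t : ℝ) : ℝ :=
  v / (1 + γ * v) -
    (c₀ ^ 2 * v / (1 + γ * (c₀ ^ 2 * v / Real.cos (Real.arctan (Real.exp t)) ^ 2)) +
      s₀ ^ 2 * v / (1 + γ * (s₀ ^ 2 * v / Real.sin (Real.arctan (Real.exp t)) ^ 2)))

theorem continuous_gaussianGap {v γ : ℝ} (hv : 0 < v) (hγ : 0 < γ) (c₀ s₀ : ℝ) :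
    Continuous (gaussianGap v γ c₀ s₀) := by
  have hct : Continuous fun t => Real.cos (Real.arctan (Real.exp t)) := by fun_prop
  have hst : Continuous fun t => Real.sin (Real.arctan (Real.exp t)) := by fun_prop
  unfold gaussianGap
  refine continuous_const.sub (Continuous.add (Continuous.div continuous_const ?_ fun t => ?_)
    (Continuous.div continuous_const ?_ fun t => ?_))
  · exact continuous_const.add (continuous_const.mul (continuous_const.div (hct.pow 2)
      fun t => (pow_pos (cos_arctan_exp_pos t) 2).ne'))
  · have := cos_arctan_exp_pos t
    positivity
  · exact continuous_const.add (continuous_const.mul (continuous_const.div (hst.pow 2)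
      fun t => (pow_pos (sin_arctan_exp_pos t) 2).ne'))
  · have := sin_arctan_exp_pos t
    positivity

/-- The gap vanishes at the angle for which the rescaled variables have the
variance of the sum. -/
theorem gaussianGap_self (v γ t : ℝ) :
    gaussianGap v γ (Real.cos (Real.arctan (Real.exp t))) (Real.sin (Real.arctan (Real.exp t))) t =
      0 := by
  have hc := cos_arctan_exp_pos t
  have hs := sin_arctan_exp_pos t
  have hcs := Real.cos_sq_add_sin_sq (Real.arctan (Real.exp t))
  rw [gaussianGap, mul_div_cancel_left₀ _ (by positivity), mul_div_cancel_left₀ _ (by positivity),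
    ← add_div, ← add_mul, hcs, one_mul, sub_self]

/-- For normal laws of variances `c₀² v` and `s₀² v`, whose sum has variance `v`, the gap of mean
square errors is `gaussianGap`. -/
theorem MMSEGap.le_gaussianGap {Ω : Type*} [MeasurableSpace Ω] {P : Measure Ω}
    [IsProbabilityMeasure P] {X₁ X₂ : Ω → ℝ} (h₁ : Measurable X₁)
    (h₂ : Measurable X₂) (hi : IndepFun X₁ X₂ P) {m₁ m₂ v c₀ s₀ γ₀ δ t : ℝ} (hv : 0 < v)
    (hγ : 0 < γ₀) (hcs : c₀ ^ 2 + s₀ ^ 2 = 1)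
    (e₁ : P.map X₁ = gaussianReal m₁ (Real.toNNReal (c₀ ^ 2 * v)))
    (e₂ : P.map X₂ = gaussianReal m₂ (Real.toNNReal (s₀ ^ 2 * v)))
    (h : MMSEGap P X₁ X₂ γ₀ δ (Real.arctan (Real.exp t))) : δ ≤ gaussianGap v γ₀ c₀ s₀ t := by
  have hconv : P.map (fun ω => X₁ ω + X₂ ω) = P.map X₁ ∗ P.map X₂ :=
    hi.map_add_eq_map_conv_map₀ h₁.aemeasurable h₂.aemeasurable
  obtain ⟨-, -, -, hle⟩ := h
  rw [map_div_eq h₁, map_div_eq h₂, hconv, e₁, e₂, gaussianReal_conv_gaussianReal,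
    mmse_gaussianReal_map_div _ (by positivity) (cos_arctan_exp_pos t) hγ.le,
    mmse_gaussianReal_map_div _ (by positivity) (sin_arctan_exp_pos t) hγ.le,
    mmse_gaussianReal _ _ hγ.le, ← Real.toNNReal_add (by positivity) (by positivity), ← add_mul,
    hcs, one_mul, Real.coe_toNNReal _ hv.le] at hle
  rw [gaussianGap]
  linarith

end WeightedEntropy

/-! ### The perturbation theorem -/

open WeightedEntropy in
theorem mainTheorem3 (f₁ f₂ : ℝ → ℝ) (γ₀ δ : ℝ) (hγ₀ : 0 < γ₀) (hδ : 0 < δ) :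
    ∃ c : ℝ, 0 < c ∧
      ∀ (Ω : Type*) [MeasurableSpace Ω] (P : Measure Ω) [IsProbabilityMeasure P] (X₁ X₂ : Ω → ℝ),
        WeightedEntropy.HasDensity P X₁ f₁ → WeightedEntropy.HasDensity P X₂ f₂ →
        IndepFun X₁ X₂ P →
        ∀ φbar : ℝ, 0 < φbar → ∀ ε : ℝ, ε < c * φbar →
        ∀ φ : ℝ → ℝ, WeightedEntropy.IsWeight φ → (∀ x, |φ x - φbar| < ε) →
          (WeightedEntropy.MMSEGap P X₁ X₂ γ₀ δ (WeightedEntropy.angle φ P X₁ X₂) ∨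
            WeightedEntropy.MMSEGap P X₁ X₂ γ₀ δ
              (WeightedEntropy.angle (fun _ => φbar) P X₁ X₂)) →
          WeightedEntropy.WLSI φ P X₁ X₂ := by
  set μ₁ : Measure ℝ := volume.withDensity fun x => ENNReal.ofReal (f₁ x) with hμ₁
  set μ₂ : Measure ℝ := volume.withDensity fun x => ENNReal.ofReal (f₂ x) with hμ₂
  have ac₁ : μ₁ ≪ volume := withDensity_absolutelyContinuous _ _
  have ac₂ : μ₂ ≪ volume := withDensity_absolutelyContinuous _ _
  by_cases hgood : (IsProbabilityMeasure μ₁ ∧ IsProbabilityMeasure μ₂) ∧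
      Integrable (fun x => Real.log (density μ₁ x)) μ₁ ∧
      Integrable (fun x => Real.log (density μ₂ x)) μ₂ ∧
      Integrable (fun x => Real.log (density (μ₁ ∗ μ₂) x)) (μ₁ ∗ μ₂)
  swap
  -- without finite entropies no pair of variables satisfies the hypotheses
  · refine ⟨1, one_pos, fun Ω _ P _ X₁ X₂ d₁ d₂ hi φbar _ ε _ φ _ _ hgap => absurd ?_ hgood⟩
    have p₁ := Measure.isProbabilityMeasure_map (μ := P) d₁.measurable.aemeasurable
    have p₂ := Measure.isProbabilityMeasure_map (μ := P) d₂.measurable.aemeasurable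
    have e₁ := d₁.map_eq
    have e₂ := d₂.map_eq
    rw [← hμ₁] at e₁
    rw [← hμ₂] at e₂
    rw [← e₁] at ac₁ ⊢
    rw [← e₂] at ac₂ ⊢
    exact ⟨⟨p₁, p₂⟩, hgap.elim
      (fun h => h.integrable_log_density d₁.measurable d₂.measurable hi ac₁ ac₂
        (cos_arctan_exp_pos _) (sin_arctan_exp_pos _))
      (fun h => h.integrable_log_density d₁.measurable d₂.measurable hi ac₁ ac₂
        (cos_arctan_exp_pos _) (sin_arctan_exp_pos _))⟩
  obtain ⟨⟨_, _⟩, i₁, i₂, i⟩ := hgood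
  set t₀ := entropy μ₂ - entropy μ₁ with ht₀
  set c₀ := Real.cos (Real.arctan (Real.exp t₀)) with hc₀
  set s₀ := Real.sin (Real.arctan (Real.exp t₀)) with hs₀
  have hc₀p : 0 < c₀ := cos_arctan_exp_pos t₀
  have hs₀p : 0 < s₀ := sin_arctan_exp_pos t₀
  have hcs₀ : c₀ ^ 2 + s₀ ^ 2 = 1 := Real.cos_sq_add_sin_sq _
  have hbal : entropy μ₁ - Real.log c₀ = entropy μ₂ - Real.log s₀ := by
    rw [hs₀, log_sin_arctan_exp, ht₀]
    ring
  set M := c₀ ^ 2 * (entropy μ₁ - Real.log c₀) + s₀ ^ 2 * (entropy μ₂ - Real.log s₀) with hM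
  have n₁ := absEntropy_nonneg μ₁
  have n₂ := absEntropy_nonneg μ₂
  have n := absEntropy_nonneg (μ₁ ∗ μ₂)
  by_cases hstrict : M < entropy (μ₁ ∗ μ₂)
  · have hL : 0 < absEntropy μ₁ + absEntropy μ₂ + absEntropy (μ₁ ∗ μ₂) + 2 := by linarith
    refine ⟨(entropy (μ₁ ∗ μ₂) - M) /
      (absEntropy μ₁ + absEntropy μ₂ + absEntropy (μ₁ ∗ μ₂) + 2), div_pos (sub_pos.2 hstrict) hL,
      fun Ω _ P _ X₁ X₂ d₁ d₂ hi φbar hφbar ε hε φ hφ hclose _ => ?_⟩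
    have e₁ := d₁.map_eq
    have e₂ := d₂.map_eq
    rw [← hμ₁] at e₁
    rw [← hμ₂] at e₂
    have hεle : ε * (absEntropy μ₁ + absEntropy μ₂ + absEntropy (μ₁ ∗ μ₂) + 2) ≤
        φbar * (entropy (μ₁ ∗ μ₂) - M) := by
      rw [div_mul_eq_mul_div, lt_div_iff₀ hL] at hε
      linarith
    have hMle : ∀ c s : ℝ, 0 < c → 0 < s → c ^ 2 + s ^ 2 = 1 →
        c ^ 2 * (entropy μ₁ - Real.log c) + s ^ 2 * (entropy μ₂ - Real.log s) ≤ M :=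
      fun c s hc hs hcs => splitting_le_of_balanced hc₀p hs₀p hc hs hcs₀ hcs hbal
    clear_value M t₀ c₀ s₀ μ₁ μ₂
    subst e₁ e₂
    exact WLSI_of_gap d₁.measurable d₂.measurable hi ac₁ ac₂ i₁ i₂ i hφ.measurable hclose hφbar
      hMle hεle
  -- equality forces normal laws, for which the gap of mean square errors vanishes at `t₀`
  · obtain ⟨v, m₁, m₂, hv, g₁, g₂⟩ := gaussian_of_lieb_splitting_eq ac₁ ac₂ i₁ i₂ i hc₀p hs₀p hcs₀
      (not_lt.1 hstrict)
    obtain ⟨r, hr, hball⟩ := Metric.eventually_nhds_iff.1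
      ((continuous_gaussianGap hv hγ₀ c₀ s₀).tendsto t₀ |>.eventually_lt_const
        (by rw [hc₀, hs₀, gaussianGap_self]; exact hδ))
    set L := 4 * (absEntropy μ₁ + absEntropy μ₂) + 1 with hL
    have hLp : 0 < L := by linarith
    refine ⟨min (1 / 2) (r / L), lt_min (by norm_num) (div_pos hr hLp),
      fun Ω _ P _ X₁ X₂ d₁ d₂ hi φbar hφbar ε hε φ hφ hclose hgap => ?_⟩
    have e₁ := d₁.map_eq
    have e₂ := d₂.map_eq
    rw [← hμ₁] at e₁
    rw [← hμ₂] at e₂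
    have hε0 : 0 ≤ ε := (abs_nonneg _).trans (hclose 0).le
    have hκ : ε / φbar < min (1 / 2) (r / L) := (div_lt_iff₀ hφbar).2 hε
    have hε2 : ε ≤ φbar / 2 := by
      have := hκ.trans_le (min_le_left _ _)
      rw [div_lt_iff₀ hφbar] at this
      linarith
    have hκr : ε / φbar * L < r := (lt_div_iff₀ hLp).1 (hκ.trans_le (min_le_right _ _))
    have hκ0 : 0 ≤ ε / φbar := div_nonneg hε0 hφbar.le
    have no_gap : ∀ t, dist t t₀ < r →
        ¬ MMSEGap P X₁ X₂ γ₀ δ (Real.arctan (Real.exp t)) := fun t ht h =>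
      (hball ht).not_ge (h.le_gaussianGap d₁.measurable d₂.measurable hi hv hγ₀ hcs₀
        (e₁.trans g₁) (e₂.trans g₂))
    refine absurd hgap (not_or.2 ⟨?_, ?_⟩)
    · rw [angle_eq d₁.measurable d₂.measurable hφ.measurable, e₁, e₂]
      refine no_gap _ ?_
      have k₁ := abs_lawEntropy_div_sub_le hφ.measurable hclose hφbar hε2 i₁
      have k₂ := abs_lawEntropy_div_sub_le hφ.measurable hclose hφbar hε2 i₂
      have k := abs_sub (lawEntropy φ μ₂ / (∫ x, φ x ∂μ₂) - entropy μ₂)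
        (lawEntropy φ μ₁ / (∫ x, φ x ∂μ₁) - entropy μ₁)
      rw [Real.dist_eq, ht₀, sub_sub_sub_comm]
      refine lt_of_le_of_lt (k.trans (add_le_add k₂ k₁)) ?_
      rw [hL] at hκr
      linarith
    · rw [angle_const d₁.measurable d₂.measurable hφbar.ne', e₁, e₂]
      exact no_gap t₀ (by rwa [dist_self])
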